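/- Let $R$ be a commutative ring with unit, $a\in R$, and $n\ge 1$. For $k,m\ge 0$ let $\mathrm{TL}(k,m)$ be the free $R$-module on the planar (non-crossing) perfect matchings, up to isotopy, of $k$ nodes on a left bar and $m$ nodes on a right bar. Composition $\mathrm{TL}(k,l)\otimes_R \mathrm{TL}(l,m)\to \mathrm{TL}(k,m)$ glues two diagrams along the common bar and replaces each closed loop by a factor $a$. Let $\mathrm{TL}_{2n}=\mathrm{TL}(2n,2n)$ be the Temperley--Lieb algebra. Let $R$ denote the trivial right $\mathrm{TL}_{2n}$-module, on which every diagram other than the identity acts by zero. Let $S(2n,0)$ be the left cell module, that is, the quotient of $\mathrm{TL}(2n,0)$ by the diagrams having an arc with both ends on the right bar (so $S(2n,0)=\mathrm{TL}(2n,0)$). Let $L(2n)=L(2n;R,a)$ be the chain complex of planar loops, with $$L(2n)_0=\mathrm{TL}(0,0)=R,\qquad L(2n)_q=\mathrm{TL}(0,2n)\otimes_R \mathrm{TL}_{2n}^{\otimes (q-1)}\otimes_R \mathrm{TL}(2n,0)\quad (q>0),$$ and differential $d(D_0|\dots|D_q)=\sum_{i=0}^{q-1}(-1)^i(D_0|\dots|D_iD_{i+1}|\dots|D_q)$.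 Then for every $q\ge 0$ there is an isomorphism of $R$-modules $$\mathrm{Tor}_q^{\mathrm{TL}_{2n}}(R,S(2n,0))\cong\begin{cases}0 & q<n-1,\\ H_{q-n+1}(L(2n)) & q\ge n-1.\end{cases}$$ -/

import Mathlib

namespace TemperleyLieb

open Relation

/-! ### Auxiliary facts on generated equivalence relations -/

theorem eqvGen_inv {X : Type*} {r : X → X → Prop} {P : X → Prop}
    (h : ∀ a b, r a b → (P a ↔ P b)) {x y : X} (hxy : EqvGen r x y) : P x ↔ P y := by
  induction hxy with
  | rel _ _ h' => exact h _ _ h'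
  | refl _ => rfl
  | symm _ _ _ ih => exact ih.symm
  | trans _ _ _ _ _ ih1 ih2 => exact ih1.trans ih2

theorem eqvGen_mono {X : Type*} {r s : X → X → Prop} (h : ∀ a b, r a b → s a b) {x y : X}
    (hxy : EqvGen r x y) : EqvGen s x y := by
  induction hxy with
  | rel _ _ h' => exact .rel _ _ (h _ _ h')
  | refl _ => exact .refl _
  | symm _ _ _ ih => exact ih.symm
  | trans _ _ _ _ _ ih1 ih2 => exact ih1.trans _ _ _ ih2

/-- If `f`, `g` are involutions of a finite set without a common fixed point, then every orbit that
contains a point fixed by `f` or by `g` contains exactly two such points. -/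
theorem two_ends_aux {X : Type*} [Finite X] {f g : X → X} (hf : Function.Involutive f)
    (hg : Function.Involutive g) (hfg : ∀ y, f y = y → g y ≠ y) {x : X} (hx : g x = x) :
    ∃! y, y ≠ x ∧ (f y = y ∨ g y = y) ∧ EqvGen (fun u v => v = f u ∨ v = g u) x y := by
  classical
  set F : Equiv.Perm X := hf.toPerm with hF
  set G : Equiv.Perm X := hg.toPerm with hG
  set s : Equiv.Perm X := G * F with hs
  have hFF : F * F = 1 := by ext y; exact hf y
  have hGG : G * G = 1 := by ext y; exact hg y
  have hGi : G⁻¹ = G := inv_eq_of_mul_eq_one_left hGG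
  have hFi : F⁻¹ = F := inv_eq_of_mul_eq_one_left hFF
  have hconj : ∀ k : ℤ, G * s ^ k = s ^ (-k) * G := by
    intro k
    have h1 : G * s * G⁻¹ = s⁻¹ := by
      rw [hs, mul_inv_rev, hFi, hGi, ← mul_assoc, hGG, one_mul]
    have h2 : G * s ^ k * G⁻¹ = s ^ (-k) := by
      rw [← conj_zpow, h1, zpow_neg, inv_zpow]
    rw [← h2, mul_assoc _ G⁻¹, inv_mul_cancel, mul_one]
  have hGx : G x = x := hx
  have hGk : ∀ k : ℤ, G ((s ^ k) x) = (s ^ (-k)) x := by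
    intro k
    have := congrArg (fun p : Equiv.Perm X => p x) (hconj k)
    simpa [Equiv.Perm.mul_apply, hGx] using this
  have hFk : ∀ k : ℤ, F ((s ^ k) x) = (s ^ (-k - 1)) x := by
    intro k
    have : F = G * s := by rw [hs, ← mul_assoc, hGG, one_mul]
    rw [this, Equiv.Perm.mul_apply, ← Equiv.Perm.mul_apply s, ← zpow_one_add, hGk]
    congr 2; ring
  have horb : ∀ y, EqvGen (fun u v => v = f u ∨ v = g u) x y → ∃ k : ℤ, y = (s ^ k) x := by
    intro y hy
    refine (eqvGen_inv (P := fun y => ∃ k : ℤ, y = (s ^ k) x) ?_ hy).1 ⟨0, by simp⟩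
    have key : ∀ a, (∃ k : ℤ, a = (s ^ k) x) →
        (∃ k : ℤ, F a = (s ^ k) x) ∧ (∃ k : ℤ, G a = (s ^ k) x) := by
      rintro _ ⟨k, rfl⟩
      exact ⟨⟨_, hFk k⟩, ⟨_, hGk k⟩⟩
    rintro a b (rfl | rfl)
    · refine ⟨fun h => (key _ h).1, fun h => ?_⟩
      have := (key _ h).1
      rwa [show F (f a) = a from hf a] at this
    · refine ⟨fun h => (key _ h).2, fun h => ?_⟩
      have := (key _ h).2
      rwa [show G (g a) = a from hg a] at this
  have hmem : ∀ k : ℕ, EqvGen (fun u v => v = f u ∨ v = g u) x ((s ^ k) x) := by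
    intro k
    induction k with
    | zero => exact EqvGen.refl _
    | succ k ih =>
      rw [pow_succ', Equiv.Perm.mul_apply]
      exact (ih.trans _ _ _ (EqvGen.rel _ (f ((s ^ k) x)) (Or.inl rfl))).trans _ _ _
        (EqvGen.rel _ _ (Or.inr rfl))
  set N := MulAction.period s x with hN
  have hNpos : 0 < N := MulAction.period_pos_of_orderOf_pos (orderOf_pos s) x
  have hfix : ∀ i j : ℤ, (s ^ i) x = (s ^ j) x ↔ (N : ℤ) ∣ i - j := by
    intro i j
    rw [hN, ← MulAction.zpow_smul_eq_iff_period_dvd, Equiv.Perm.smul_def, sub_eq_neg_add, zpow_add,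
      zpow_neg, Equiv.Perm.mul_apply, Equiv.Perm.inv_eq_iff_eq]
  have hx0 : ∀ i : ℤ, (s ^ i) x = x ↔ (N : ℤ) ∣ i := by
    intro i; simpa using hfix i 0
  have hends : ∀ k : ℤ, (f ((s ^ k) x) = (s ^ k) x ∨ g ((s ^ k) x) = (s ^ k) x) ↔
      ((N : ℤ) ∣ 2 * k + 1 ∨ (N : ℤ) ∣ 2 * k) := by
    intro k
    rw [show f ((s ^ k) x) = _ from hFk k, show g ((s ^ k) x) = _ from hGk k, hfix, hfix,
      ← dvd_neg, ← dvd_neg (b := -k - k)]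
    ring_nf
  have hN1 : N ≠ 1 := by
    intro h
    have h1 := hFk 0
    rw [(hx0 (-0 - 1)).2 (by simp [h]), (hx0 0).2 (by simp)] at h1
    exact hfg x h1 hx
  rcases Nat.even_or_odd' N with ⟨k, hk | hk⟩
  · refine ⟨(s ^ k) x, ⟨?_, ?_, hmem k⟩, ?_⟩
    · intro h
      have := (hx0 k).1 (by simpa using h)
      have := Int.le_of_dvd (by omega) this
      omega
    · exact (hends k).2 (Or.inr ⟨1, by rw [hk]; push_cast; ring⟩)
    · rintro y ⟨h1, h2, h3⟩
      obtain ⟨j, rfl⟩ := horb y h3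
      rw [hends] at h2
      rw [Ne, hx0] at h1
      rw [← zpow_natCast, hfix]
      rcases h2 with ⟨t, ht⟩ | ⟨t, ht⟩
      · rw [hk] at ht; push_cast at ht
        have : (2:ℤ) ∣ 1 := ⟨k * t - j, by linarith⟩
        omega
      · rw [hk] at ht h1 ⊢; push_cast at ht h1 ⊢
        have hj : j = k * t := by linarith
        rcases Int.even_or_odd' t with ⟨c, rfl | rfl⟩
        · exact absurd ⟨c, by rw [hj]; ring⟩ h1
        · exact ⟨c, by rw [hj]; ring⟩
  · refine ⟨(s ^ k) x, ⟨?_, ?_, hmem k⟩, ?_⟩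
    · intro h
      have := (hx0 k).1 (by simpa using h)
      have := Int.le_of_dvd (by omega) this
      omega
    · exact (hends k).2 (Or.inl ⟨1, by rw [hk]; push_cast; ring⟩)
    · rintro y ⟨h1, h2, h3⟩
      obtain ⟨j, rfl⟩ := horb y h3
      rw [hends] at h2
      rw [Ne, hx0] at h1
      rw [← zpow_natCast, hfix]
      have hcop : IsCoprime (N : ℤ) 2 := by
        rw [hk]; exact ⟨1, -k, by push_cast; ring⟩
      rcases h2 with h2 | h2
      · refine hcop.dvd_of_dvd_mul_left ?_
        have : (N : ℤ) ∣ (2 * j + 1) - N := dvd_sub_self_right.2 h2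
        have e : (2 * j + 1) - (N : ℤ) = 2 * (j - k) := by rw [hk]; push_cast; ring
        rwa [e] at this
      · exact absurd (hcop.dvd_of_dvd_mul_left h2) h1

section
variable {Z Y : Type*}

theorem eqvGen_transfer {a b : Z → Z → Prop} {k : Y → Y → Prop} {ι : Y → Z}
    (H1 : ∀ s t, k s t → EqvGen (fun z z' => a z z' ∨ b z z') (ι s) (ι t))
    (H2 : ∀ s t, EqvGen a (ι s) (ι t) → EqvGen k s t)
    (H3 : ∀ z z', b z z' → ∃ s t, z = ι s ∧ z' = ι t ∧ EqvGen k s t) (x y : Y) :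
    EqvGen k x y ↔ EqvGen (fun z z' => a z z' ∨ b z z') (ι x) (ι y) := by
  constructor
  · intro h
    induction h with
    | rel s t h => exact H1 s t h
    | refl => exact EqvGen.refl _
    | symm _ _ _ ih => exact ih.symm
    | trans _ _ _ _ _ ih1 ih2 => exact ih1.trans _ _ _ ih2
  · intro h
    obtain ⟨s, hs, hs'⟩ := (eqvGen_inv (P := fun z => ∃ s, EqvGen k x s ∧ EqvGen a (ι s) z)
      (by
        rintro z z' (h | h)
        · exact ⟨fun ⟨s, h1, h2⟩ => ⟨s, h1, h2.trans _ _ _ (.rel _ _ h)⟩,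
            fun ⟨s, h1, h2⟩ => ⟨s, h1, h2.trans _ _ _ ((EqvGen.rel _ _ h).symm)⟩⟩
        · obtain ⟨u, v, rfl, rfl, huv⟩ := H3 _ _ h
          exact ⟨fun ⟨s, h1, h2⟩ => ⟨v, (h1.trans _ _ _ (H2 _ _ h2)).trans _ _ _ huv, .refl _⟩,
            fun ⟨s, h1, h2⟩ => ⟨u, (h1.trans _ _ _ (H2 _ _ h2)).trans _ _ _ huv.symm, .refl _⟩⟩)
      h).1 ⟨x, .refl _, .refl _⟩
    exact hs.trans _ _ _ (H2 _ _ hs')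

/-- The classes of the equivalence relation generated by `r` that are contained in `U`. -/
def classesIn {X : Type*} (r : X → X → Prop) (U : Set X) : Set (Set X) :=
  {s | s ∈ (EqvGen.setoid r).classes ∧ s ⊆ U}

theorem mem_classesIn {X : Type*} {r : X → X → Prop} {U s : Set X} :
    s ∈ classesIn r U ↔ (∃ x, s = {y | EqvGen r y x}) ∧ s ⊆ U := Iff.rfl

theorem ncard_classesIn_transfer [Finite Z] {a b : Z → Z → Prop} {k : Y → Y → Prop} {ι : Y → Z}
    (H1 : ∀ s t, k s t → EqvGen (fun z z' => a z z' ∨ b z z') (ι s) (ι t))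
    (H2 : ∀ s t, EqvGen a (ι s) (ι t) → EqvGen k s t)
    (H3 : ∀ z z', b z z' → ∃ s t, z = ι s ∧ z' = ι t ∧ EqvGen k s t) (V : Set Y) (U : Set Z)
    (hU : ∀ z, z ∈ U ↔ ∀ y, z = ι y → y ∈ V) :
    (classesIn (fun z z' => a z z' ∨ b z z') U).ncard =
      (classesIn a (Set.range ι)ᶜ).ncard + (classesIn k V).ncard := by
  have htr := eqvGen_transfer H1 H2 H3
  set T := fun z z' => a z z' ∨ b z z' with hT
  have haT : ∀ z z', EqvGen a z z' → EqvGen T z z' := fun z z' h => eqvGen_mono (fun _ _ => Or.inl) h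
  have hcl : ∀ x z, {y | EqvGen a y x} ⊆ (Set.range ι)ᶜ → (EqvGen T z x ↔ EqvGen a z x) := by
    intro x z hx
    refine ⟨fun h => ?_, haT _ _⟩
    refine (eqvGen_inv (P := fun z => EqvGen a z x) ?_ h).2 (.refl _)
    rintro z z' (h | h)
    · exact ⟨fun h' => (EqvGen.rel _ _ h).symm.trans _ _ _ h',
        fun h' => (EqvGen.rel _ _ h).trans _ _ _ h'⟩
    · obtain ⟨s, t, rfl, rfl, -⟩ := H3 _ _ h
      exact ⟨fun h' => absurd (Set.mem_range_self s) (hx h'),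
        fun h' => absurd (Set.mem_range_self t) (hx h')⟩
  have hsplit : classesIn T U = classesIn a (Set.range ι)ᶜ ∪
      {s | s ∈ classesIn T U ∧ ∃ y, ι y ∈ s} := by
    ext s
    constructor
    · intro hs
      by_cases hy : ∃ y, ι y ∈ s
      · exact Or.inr ⟨hs, hy⟩
      · left
        obtain ⟨⟨x, rfl⟩, hsU⟩ := hs
        have hsub : {y | EqvGen a y x} ⊆ (Set.range ι)ᶜ := by
          rintro _ hz ⟨y, rfl⟩
          exact hy ⟨y, haT _ _ hz⟩
        refine ⟨⟨x, ?_⟩, ?_⟩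
        · ext z; exact hcl x z hsub
        · rintro _ hz ⟨y, rfl⟩
          exact hy ⟨y, hz⟩
    · rintro (⟨⟨x, rfl⟩, hs⟩ | ⟨h, -⟩)
      · refine ⟨⟨x, ?_⟩, ?_⟩
        · ext z; exact (hcl x z hs).symm
        · intro z hz
          rw [hU]
          rintro y rfl
          exact absurd (Set.mem_range_self y) (hs hz)
      · exact h
  have hdisj : Disjoint (classesIn a (Set.range ι)ᶜ)
      {s | s ∈ classesIn T U ∧ ∃ y, ι y ∈ s} := by
    rw [Set.disjoint_left]
    rintro s ⟨-, hs⟩ ⟨-, y, hy⟩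
    exact hs hy (Set.mem_range_self y)
  have himg : (Set.preimage ι) '' {s | s ∈ classesIn T U ∧ ∃ y, ι y ∈ s} = classesIn k V := by
    ext s
    constructor
    · rintro ⟨_, ⟨⟨⟨x, rfl⟩, hs⟩, y, hy⟩, rfl⟩
      refine ⟨⟨y, ?_⟩, ?_⟩
      · ext t
        change EqvGen T (ι t) x ↔ EqvGen k t y
        rw [htr]
        exact ⟨fun h => h.trans _ _ _ (EqvGen.symm _ _ hy), fun h => h.trans _ _ _ hy⟩
      · intro t ht
        exact (hU _).1 (hs ht) t rfl
    · rintro ⟨⟨y, rfl⟩, hs⟩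
      refine ⟨{z | EqvGen T z (ι y)}, ⟨⟨⟨ι y, rfl⟩, ?_⟩, y, .refl _⟩, ?_⟩
      · intro z hz
        rw [hU]
        rintro t rfl
        exact hs ((htr _ _).2 hz)
      · ext t; exact (htr _ _).symm
  have hinj : Set.InjOn (Set.preimage ι) {s | s ∈ classesIn T U ∧ ∃ y, ι y ∈ s} := by
    rintro _ ⟨⟨⟨x, rfl⟩, -⟩, y, hy⟩ _ ⟨⟨⟨x', rfl⟩, -⟩, -⟩ h
    have h1 : y ∈ ι ⁻¹' {y | EqvGen T y x'} := h ▸ hy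
    have hy : EqvGen T (ι y) x := hy
    have h1 : EqvGen T (ι y) x' := h1
    ext z
    have hxx : EqvGen T x x' := hy.symm.trans _ _ _ h1
    exact ⟨fun h => EqvGen.trans _ _ _ h hxx, fun h => EqvGen.trans _ _ _ h hxx.symm⟩
  rw [hsplit, Set.ncard_union_eq hdisj (Set.toFinite _) (Set.toFinite _), ← himg,
    hinj.ncard_image]

theorem eqvGen_emb {e : Y → Z} (he : Function.Injective e) {r : Y → Y → Prop} {a : Z → Z → Prop}
    (ha : ∀ z z', a z z' ↔ ∃ u v, z = e u ∧ z' = e v ∧ r u v) (z z' : Z) :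
    EqvGen a z z' ↔ z = z' ∨ ∃ u v, z = e u ∧ z' = e v ∧ EqvGen r u v := by
  constructor
  · intro h
    induction h with
    | rel _ _ h =>
      obtain ⟨u, v, rfl, rfl, h'⟩ := (ha _ _).1 h
      exact Or.inr ⟨u, v, rfl, rfl, .rel _ _ h'⟩
    | refl => exact Or.inl rfl
    | symm _ _ _ ih =>
      rcases ih with rfl | ⟨u, v, rfl, rfl, h⟩
      · exact Or.inl rfl
      · exact Or.inr ⟨v, u, rfl, rfl, h.symm⟩
    | trans _ _ _ _ _ ih1 ih2 =>
      rcases ih1 with rfl | ⟨u, v, rfl, rfl, h⟩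
      · exact ih2
      · rcases ih2 with rfl | ⟨u', v', h', rfl, h2⟩
        · exact Or.inr ⟨u, v, rfl, rfl, h⟩
        · obtain rfl := he h'
          exact Or.inr ⟨u, v', rfl, rfl, h.trans _ _ _ h2⟩
  · rintro (rfl | ⟨u, v, rfl, rfl, h⟩)
    · exact .refl _
    · induction h with
      | rel s t h => exact .rel _ _ ((ha _ _).2 ⟨s, t, rfl, rfl, h⟩)
      | refl => exact EqvGen.refl _
      | symm _ _ _ ih => exact ih.symm
      | trans _ _ _ _ _ ih1 ih2 => exact ih1.trans _ _ _ ih2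

theorem ncard_classesIn_emb {e : Y → Z} (he : Function.Injective e) {r : Y → Y → Prop}
    {a : Z → Z → Prop} (ha : ∀ z z', a z z' ↔ ∃ u v, z = e u ∧ z' = e v ∧ r u v)
    (V : Set Y) (U : Set Z) (hUV : U = e '' V) :
    (classesIn a U).ncard = (classesIn r V).ncard := by
  have hcl : ∀ u, {z | EqvGen a z (e u)} = e '' {y | EqvGen r y u} := by
    intro u
    ext z
    change EqvGen a z (e u) ↔ _
    rw [eqvGen_emb he ha]
    constructor
    · rintro (rfl | ⟨v, w, rfl, h, h'⟩)
      · exact ⟨u, .refl _, rfl⟩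
      · obtain rfl := he h
        exact ⟨v, h', rfl⟩
    · rintro ⟨v, h, rfl⟩
      exact Or.inr ⟨v, u, rfl, rfl, h⟩
  have : classesIn a U = (Set.image e) '' classesIn r V := by
    ext s
    constructor
    · rintro ⟨⟨z, rfl⟩, hs⟩
      have hz : z ∈ U := hs (EqvGen.refl z)
      rw [hUV] at hz
      obtain ⟨u, hu, rfl⟩ := hz
      refine ⟨_, ⟨⟨u, rfl⟩, ?_⟩, (hcl u).symm⟩
      change {z | EqvGen a z (e u)} ⊆ U at hs
      rw [hcl, hUV] at hs
      exact (Set.image_subset_image_iff he).1 hs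
    · rintro ⟨_, ⟨⟨u, rfl⟩, hs⟩, rfl⟩
      exact ⟨⟨e u, (hcl u).symm⟩, hUV ▸ Set.image_mono hs⟩
  rw [this, Set.ncard_image_of_injective _ he.image_injective]
end

/-! ### Gluing two matchings along a common set of nodes -/

section
variable {A B C E : Type*}

/-- Inclusion of the nodes of the left diagram into the nodes of the glued picture. -/
abbrev gLeft : A ⊕ B → A ⊕ (B ⊕ C) := Sum.map id Sum.inl
/-- Inclusion of the nodes that remain after gluing (those on the two outer bars). -/
abbrev gOuter : A ⊕ C → A ⊕ (B ⊕ C) := Sum.map id Sum.inr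

/-- Put a matching `f` of the nodes `A ⊕ B` to the left of a matching `g` of the nodes `B ⊕ C`,
identifying the two copies of `B`. Two nodes are adjacent if an arc of `f` or of `g` joins them. -/
def glueAdj (f : A ⊕ B → A ⊕ B) (g : B ⊕ C → B ⊕ C) (x y : A ⊕ (B ⊕ C)) : Prop :=
  (∃ u, x = gLeft u ∧ y = gLeft (f u)) ∨ (∃ v, x = Sum.inr v ∧ y = Sum.inr (g v))

/-- The number of closed loops created by gluing: connected components all of whose nodes lie on
the middle bar `B`. -/
noncomputable def gLoops (f : A ⊕ B → A ⊕ B) (g : B ⊕ C → B ⊕ C) : ℕ :=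
  (classesIn (glueAdj f g) (Set.range fun b : B => Sum.inr (Sum.inl b))).ncard

/-- The matching `f`, extended by the identity on `C`. -/
def extL (f : A ⊕ B → A ⊕ B) : A ⊕ (B ⊕ C) → A ⊕ (B ⊕ C)
  | Sum.inl x => gLeft (f (Sum.inl x))
  | Sum.inr (Sum.inl x) => gLeft (f (Sum.inr x))
  | Sum.inr (Sum.inr x) => Sum.inr (Sum.inr x)

/-- The matching `g`, extended by the identity on `A`. -/
def extR (g : B ⊕ C → B ⊕ C) : A ⊕ (B ⊕ C) → A ⊕ (B ⊕ C)
  | Sum.inl x => Sum.inl x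
  | Sum.inr x => Sum.inr (g x)

theorem gLeft_inj : Function.Injective (gLeft : A ⊕ B → A ⊕ (B ⊕ C)) :=
  Function.injective_id.sumMap Sum.inl_injective

theorem gOuter_inj : Function.Injective (gOuter : A ⊕ C → A ⊕ (B ⊕ C)) :=
  Function.injective_id.sumMap Sum.inr_injective

theorem extL_gLeft (f : A ⊕ B → A ⊕ B) (u) : extL (C := C) f (gLeft u) = gLeft (f u) := by
  rcases u with u | u <;> rfl

theorem glue_iff (f : A ⊕ B → A ⊕ B) (g : B ⊕ C → B ⊕ C) (x y : A ⊕ (B ⊕ C)) :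
    EqvGen (glueAdj f g) x y ↔ EqvGen (fun u v => v = extL f u ∨ v = extR g u) x y := by
  have h1 : ∀ x y, glueAdj f g x y → y = extL f x ∨ y = extR g x := by
    rintro x y (⟨u, rfl, rfl⟩ | ⟨v, rfl, rfl⟩)
    · exact Or.inl (extL_gLeft f u).symm
    · exact Or.inr rfl
  refine ⟨fun h => eqvGen_mono h1 h, fun h => ?_⟩
  induction h with
  | rel x y h =>
    rcases h with rfl | rfl
    · rcases x with x | x | x
      · exact .rel _ _ (Or.inl ⟨Sum.inl x, rfl, rfl⟩)
      · exact .rel _ _ (Or.inl ⟨Sum.inr x, rfl, rfl⟩)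
      · exact .refl _
    · rcases x with x | x
      · exact .refl _
      · exact .rel _ _ (Or.inr ⟨x, rfl, rfl⟩)
  | refl => exact EqvGen.refl _
  | symm _ _ _ ih => exact ih.symm
  | trans _ _ _ _ _ ih1 ih2 => exact ih1.trans _ _ _ ih2

theorem exists_glue_partner [Finite A] [Finite B] [Finite C] {f : A ⊕ B → A ⊕ B}
    {g : B ⊕ C → B ⊕ C} (hf : ∀ x, f (f x) = x) (hf' : ∀ x, f x ≠ x)
    (hg : ∀ x, g (g x) = x) (hg' : ∀ x, g x ≠ x) (u : A ⊕ C) :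
    ∃! v, v ≠ u ∧ EqvGen (glueAdj f g) (gOuter u) (gOuter v) := by
  have hF : Function.Involutive (extL (C := C) f) := by
    intro x
    rcases x with x | x | x
    · change extL f (gLeft _) = _; rw [extL_gLeft, hf]; rfl
    · change extL f (gLeft _) = _; rw [extL_gLeft, hf]; rfl
    · rfl
  have hG : Function.Involutive (extR (A := A) g) := by
    intro x
    rcases x with x | x
    · rfl
    · change Sum.inr _ = _; rw [hg]
  have hFf : ∀ x, extL (C := C) f x = x ↔ ∃ c, x = Sum.inr (Sum.inr c) := by
    intro x
    rcases x with x | x | x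
    · refine ⟨fun h => absurd (gLeft_inj (a₂ := Sum.inl x) h) (hf' _), fun ⟨c, h⟩ => by cases h⟩
    · refine ⟨fun h => absurd (gLeft_inj (a₂ := Sum.inr x) h) (hf' _), fun ⟨c, h⟩ => by cases h⟩
    · exact ⟨fun _ => ⟨x, rfl⟩, fun _ => rfl⟩
  have hGf : ∀ x, extR (A := A) g x = x ↔ ∃ c, x = Sum.inl c := by
    intro x
    rcases x with x | x
    · exact ⟨fun _ => ⟨x, rfl⟩, fun _ => rfl⟩
    · exact ⟨fun h => absurd (Sum.inr_injective h) (hg' _), fun ⟨c, h⟩ => by cases h⟩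
  have hFG : ∀ y, extL (C := C) f y = y → extR (A := A) g y ≠ y := by
    intro y h1 h2
    obtain ⟨c, rfl⟩ := (hFf y).1 h1
    obtain ⟨c, h⟩ := (hGf _).1 h2
    cases h
  have hend : ∀ y, (extL (C := C) f y = y ∨ extR (A := A) g y = y) ↔ ∃ v, y = gOuter v := by
    intro y
    rw [hFf, hGf]
    constructor
    · rintro (⟨c, rfl⟩ | ⟨c, rfl⟩)
      · exact ⟨Sum.inr c, rfl⟩
      · exact ⟨Sum.inl c, rfl⟩
    · rintro ⟨c | c, rfl⟩
      · exact Or.inr ⟨c, rfl⟩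
      · exact Or.inl ⟨c, rfl⟩
  have main : ∃! y, y ≠ gOuter u ∧ (extL (C := C) f y = y ∨ extR (A := A) g y = y) ∧
      EqvGen (glueAdj f g) (gOuter u) y := by
    simp only [glue_iff]
    rcases (hend _).2 ⟨u, rfl⟩ with h | h
    · have := two_ends_aux hG hF (fun y h1 h2 => hFG y h2 h1) h
      simpa only [or_comm] using this
    · exact two_ends_aux hF hG hFG h
  obtain ⟨y, ⟨h1, h2, h3⟩, h4⟩ := main
  obtain ⟨v, rfl⟩ := (hend y).1 h2
  refine ⟨v, ⟨fun h => h1 (h ▸ rfl), h3⟩, ?_⟩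
  rintro w ⟨hw, hw'⟩
  exact gOuter_inj (h4 _ ⟨fun h => hw (gOuter_inj h), (hend _).2 ⟨w, rfl⟩, hw'⟩)

/-- `c` matches two outer nodes exactly if they are joined by a path in the glued picture. -/
def IsGlue (f : A ⊕ B → A ⊕ B) (g : B ⊕ C → B ⊕ C) (c : A ⊕ C → A ⊕ C) : Prop :=
  ∀ u v, EqvGen (glueAdj f g) (gOuter u) (gOuter v) ↔ v = u ∨ v = c u

section assoc
variable {f : A ⊕ B → A ⊕ B} {g : B ⊕ C → B ⊕ C} {h : C ⊕ E → C ⊕ E}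
  {c : A ⊕ C → A ⊕ C} {d : B ⊕ E → B ⊕ E}

/-- The arcs of `f` in the threefold gluing. -/
def edgeF (f : A ⊕ B → A ⊕ B) (z z' : A ⊕ (B ⊕ (C ⊕ E))) : Prop :=
  ∃ u, z = gLeft u ∧ z' = gLeft (f u)

/-- The arcs of `g` in the threefold gluing. -/
def edgeG (g : B ⊕ C → B ⊕ C) (z z' : A ⊕ (B ⊕ (C ⊕ E))) : Prop :=
  ∃ u, z = Sum.inr (gLeft u) ∧ z' = Sum.inr (gLeft (g u))

/-- The arcs of `h` in the threefold gluing. -/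
def edgeH (h : C ⊕ E → C ⊕ E) (z z' : A ⊕ (B ⊕ (C ⊕ E))) : Prop :=
  ∃ u, z = Sum.inr (Sum.inr u) ∧ z' = Sum.inr (Sum.inr (h u))

/-- The nodes of the first two matchings among those of the threefold gluing. -/
def embL : A ⊕ (B ⊕ C) → A ⊕ (B ⊕ (C ⊕ E)) := Sum.map id (Sum.map id Sum.inl)

theorem embL_inj : Function.Injective (embL : A ⊕ (B ⊕ C) → A ⊕ (B ⊕ (C ⊕ E))) :=
  Function.injective_id.sumMap (Function.injective_id.sumMap Sum.inl_injective)

theorem edgeFG_iff (z z' : A ⊕ (B ⊕ (C ⊕ E))) : (edgeF f z z' ∨ edgeG g z z') ↔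
    ∃ u v, z = embL u ∧ z' = embL v ∧ glueAdj f g u v := by
  have e1 : ∀ u : A ⊕ B, embL (E := E) (gLeft (C := C) u) = gLeft u := by
    rintro (u | u) <;> rfl
  have e2 : ∀ u : B ⊕ C, embL (A := A) (E := E) (Sum.inr u) = Sum.inr (gLeft u) := by
    rintro (u | u) <;> rfl
  constructor
  · rintro (⟨u, rfl, rfl⟩ | ⟨u, rfl, rfl⟩)
    · exact ⟨_, _, (e1 _).symm, (e1 _).symm, Or.inl ⟨u, rfl, rfl⟩⟩
    · exact ⟨_, _, (e2 _).symm, (e2 _).symm, Or.inr ⟨u, rfl, rfl⟩⟩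
  · rintro ⟨_, _, rfl, rfl, ⟨u, rfl, rfl⟩ | ⟨u, rfl, rfl⟩⟩
    · exact Or.inl ⟨u, e1 _, e1 _⟩
    · exact Or.inr ⟨u, e2 _, e2 _⟩

theorem edgeGH_iff (z z' : A ⊕ (B ⊕ (C ⊕ E))) : (edgeG g z z' ∨ edgeH h z z') ↔
    ∃ u v, z = Sum.inr u ∧ z' = Sum.inr v ∧ glueAdj g h u v := by
  constructor
  · rintro (⟨u, rfl, rfl⟩ | ⟨u, rfl, rfl⟩)
    · exact ⟨_, _, rfl, rfl, Or.inl ⟨u, rfl, rfl⟩⟩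
    · exact ⟨_, _, rfl, rfl, Or.inr ⟨u, rfl, rfl⟩⟩
  · rintro ⟨_, _, rfl, rfl, ⟨u, rfl, rfl⟩ | ⟨u, rfl, rfl⟩⟩
    · exact Or.inl ⟨u, rfl, rfl⟩
    · exact Or.inr ⟨u, rfl, rfl⟩

/-- All arcs of the threefold gluing. -/
def edgeT (f : A ⊕ B → A ⊕ B) (g : B ⊕ C → B ⊕ C) (h : C ⊕ E → C ⊕ E)
    (z z' : A ⊕ (B ⊕ (C ⊕ E))) : Prop := edgeF f z z' ∨ edgeG g z z' ∨ edgeH h z z'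

/-- The threefold gluing without the bar `B`. -/
def iotaL : A ⊕ (C ⊕ E) → A ⊕ (B ⊕ (C ⊕ E)) := Sum.map id Sum.inr

/-- The threefold gluing without the bar `C`. -/
def iotaR : A ⊕ (B ⊕ E) → A ⊕ (B ⊕ (C ⊕ E)) := Sum.map id (Sum.map id Sum.inr)

theorem assocL_aux (hc : IsGlue f g c) :
    (∀ s t, glueAdj c h s t → EqvGen (fun z z' => (edgeF f z z' ∨ edgeG g z z') ∨ edgeH h z z')
      (iotaL s) (iotaL t)) ∧
    (∀ s t, EqvGen (fun z z' => edgeF f z z' ∨ edgeG (E := E) g z z') (iotaL s) (iotaL t) →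
      EqvGen (glueAdj c h) s t) ∧
    (∀ z z' : A ⊕ (B ⊕ (C ⊕ E)), edgeH h z z' → ∃ s t, z = iotaL s ∧ z' = iotaL t ∧ EqvGen (glueAdj c h) s t) := by
  have e1 : ∀ u : A ⊕ C, iotaL (B := B) (E := E) (gLeft u) = embL (gOuter u) := by
    rintro (u | u) <;> rfl
  refine ⟨?_, ?_, ?_⟩
  · rintro _ _ (⟨u, rfl, rfl⟩ | ⟨u, rfl, rfl⟩)
    · refine eqvGen_mono (r := fun z z' => edgeF f z z' ∨ edgeG g z z') (fun _ _ => Or.inl) ?_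
      rw [eqvGen_emb embL_inj edgeFG_iff]
      exact Or.inr ⟨_, _, e1 _, e1 _, (hc _ _).2 (Or.inr rfl)⟩
    · exact .rel _ _ (Or.inr ⟨u, rfl, rfl⟩)
  · intro s t hst
    rw [eqvGen_emb embL_inj edgeFG_iff] at hst
    rcases hst with hst | ⟨u, v, hu, hv, huv⟩
    · have : Function.Injective (iotaL : A ⊕ (C ⊕ E) → A ⊕ (B ⊕ (C ⊕ E))) :=
        Function.injective_id.sumMap Sum.inr_injective
      rw [this hst]; exact .refl _
    · have key : ∀ (s : A ⊕ (C ⊕ E)) (u : A ⊕ (B ⊕ C)), iotaL s = embL u →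
          ∃ w, s = gLeft w ∧ u = gOuter w := by
        rintro (s | s | s) (u | u | u) h <;> simp [iotaL, embL] at h
        · exact ⟨Sum.inl s, rfl, by rw [h]; rfl⟩
        · exact ⟨Sum.inr s, rfl, by rw [h]; rfl⟩
      obtain ⟨w, rfl, rfl⟩ := key _ _ hu
      obtain ⟨w', rfl, rfl⟩ := key _ _ hv
      rcases (hc _ _).1 huv with rfl | rfl
      · exact .refl _
      · exact .rel _ _ (Or.inl ⟨w, rfl, rfl⟩)
  · rintro _ _ ⟨u, rfl, rfl⟩
    exact ⟨Sum.inr u, Sum.inr (h u), rfl, rfl, .rel _ _ (Or.inr ⟨u, rfl, rfl⟩)⟩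

theorem assocR_aux (hd : IsGlue g h d) :
    (∀ s t, glueAdj f d s t → EqvGen (fun z z' => (edgeG g z z' ∨ edgeH h z z') ∨ edgeF f z z')
      (iotaR s) (iotaR t)) ∧
    (∀ s t, EqvGen (fun z z' => edgeG (A := A) g z z' ∨ edgeH h z z') (iotaR s) (iotaR t) →
      EqvGen (glueAdj f d) s t) ∧
    (∀ z z' : A ⊕ (B ⊕ (C ⊕ E)), edgeF f z z' → ∃ s t, z = iotaR s ∧ z' = iotaR t ∧ EqvGen (glueAdj f d) s t) := by
  have e1 : ∀ u : A ⊕ B, iotaR (C := C) (E := E) (gLeft u) = gLeft u := by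
    rintro (u | u) <;> rfl
  refine ⟨?_, ?_, ?_⟩
  · rintro _ _ (⟨u, rfl, rfl⟩ | ⟨u, rfl, rfl⟩)
    · exact .rel _ _ (Or.inr ⟨u, e1 _, e1 _⟩)
    · refine eqvGen_mono (r := fun z z' => edgeG g z z' ∨ edgeH h z z') (fun _ _ => Or.inl) ?_
      rw [eqvGen_emb Sum.inr_injective edgeGH_iff]
      exact Or.inr ⟨_, _, rfl, rfl, (hd _ _).2 (Or.inr rfl)⟩
  · intro s t hst
    rw [eqvGen_emb Sum.inr_injective edgeGH_iff] at hst
    rcases hst with hst | ⟨u, v, hu, hv, huv⟩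
    · have : Function.Injective (iotaR : A ⊕ (B ⊕ E) → A ⊕ (B ⊕ (C ⊕ E))) :=
        Function.injective_id.sumMap (Function.injective_id.sumMap Sum.inr_injective)
      rw [this hst]; exact .refl _
    · have key : ∀ (s : A ⊕ (B ⊕ E)) (u : B ⊕ (C ⊕ E)), iotaR s = Sum.inr u →
          ∃ w, s = Sum.inr w ∧ u = gOuter w := by
        rintro (s | s) u h
        · cases h
        · exact ⟨s, rfl, (Sum.inr_injective h).symm⟩
      obtain ⟨w, rfl, rfl⟩ := key _ _ hu
      obtain ⟨w', rfl, rfl⟩ := key _ _ hv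
      rcases (hd _ _).1 huv with rfl | rfl
      · exact .refl _
      · exact .rel _ _ (Or.inr ⟨w, rfl, rfl⟩)
  · rintro _ _ ⟨u, rfl, rfl⟩
    exact ⟨gLeft u, gLeft (f u), (e1 _).symm, (e1 _).symm, .rel _ _ (Or.inl ⟨u, rfl, rfl⟩)⟩

theorem edgeT_L : edgeT f g h = fun z z' => (edgeF f z z' ∨ edgeG g z z') ∨ edgeH h z z' := by
  funext z z'; simp only [edgeT, or_assoc]

theorem edgeT_R : edgeT f g h = fun z z' => (edgeG g z z' ∨ edgeH h z z') ∨ edgeF f z z' := by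
  funext z z'; simp only [edgeT]; rw [or_comm]

theorem glue_assoc (hc : IsGlue f g c) (hd : IsGlue g h d) (u v : A ⊕ E) :
    EqvGen (glueAdj c h) (gOuter u) (gOuter v) ↔ EqvGen (glueAdj f d) (gOuter u) (gOuter v) := by
  obtain ⟨h1, h2, h3⟩ := assocL_aux (h := h) hc
  obtain ⟨h1', h2', h3'⟩ := assocR_aux (f := f) hd
  rw [eqvGen_transfer h1 h2 h3, eqvGen_transfer h1' h2' h3', ← edgeT_L, ← edgeT_R]
  have e : ∀ u : A ⊕ E, iotaL (B := B) (gOuter (B := C) u) = iotaR (gOuter u) := by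
    rintro (u | u) <;> rfl
  rw [e, e]

theorem gLoops_assoc [Finite A] [Finite B] [Finite C] [Finite E]
    (hc : IsGlue f g c) (hd : IsGlue g h d) :
    gLoops f g + gLoops c h = gLoops g h + gLoops f d := by
  obtain ⟨h1, h2, h3⟩ := assocL_aux (h := h) hc
  obtain ⟨h1', h2', h3'⟩ := assocR_aux (f := f) hd
  let U : Set (A ⊕ (B ⊕ (C ⊕ E))) :=
    (Set.range fun b : B => Sum.inr (Sum.inl b)) ∪ Set.range fun b : C => Sum.inr (Sum.inr (Sum.inl b))
  have hL : (classesIn (edgeT f g h) U).ncard = gLoops f g + gLoops c h := by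
    rw [edgeT_L, ncard_classesIn_transfer h1 h2 h3 (Set.range fun b : C => Sum.inr (Sum.inl b)) U]
    · rw [ncard_classesIn_emb embL_inj edgeFG_iff (Set.range fun b : B => Sum.inr (Sum.inl b))]
      · rfl
      · ext z
        rcases z with z | z | z | z <;> simp [iotaL, embL]
    · intro z
      rcases z with z | z | z | z <;> simp [iotaL, U]
  have hR : (classesIn (edgeT f g h) U).ncard = gLoops g h + gLoops f d := by
    rw [edgeT_R, ncard_classesIn_transfer h1' h2' h3' (Set.range fun b : B => Sum.inr (Sum.inl b)) U]
    · rw [ncard_classesIn_emb Sum.inr_injective edgeGH_iff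
        (Set.range fun b : C => Sum.inr (Sum.inl b))]
      · rfl
      · ext z
        rcases z with z | z | z | z <;> simp [iotaR]
    · intro z
      rcases z with z | z | z | z <;> simp [iotaR, U]
  rw [← hL, hR]
end assoc
end

/-! ### Planar diagrams -/

section
open Finset

/-- Position of a node on the boundary of the strip, read clockwise: up the left bar (`m` nodes,
labelled `0, …, m - 1` from bottom to top), then down the right bar (`n` nodes, labelled
`0, …, n - 1` from bottom to top). -/
def bdPos {m n : ℕ} : Fin m ⊕ Fin n → ℕ
  | Sum.inl i => i
  | Sum.inr j => m + (n - 1 - j)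

theorem bdPos_inj {m n : ℕ} : Function.Injective (bdPos : Fin m ⊕ Fin n → ℕ) := by
  rintro (i | i) (j | j) h <;> simp only [bdPos] at h
  · rw [Fin.ext h]
  · omega
  · omega
  · congr 1; ext; omega

/-- A Temperley--Lieb `(m, n)`-diagram up to isotopy: a perfect matching of the `m` nodes on the
left bar and the `n` nodes on the right bar (`partner x` is the other end of the arc at `x`) no two
arcs of which cross, i.e. the endpoints of two arcs never alternate along the boundary. -/
@[ext]
structure Diagram (m n : ℕ) where
  partner : Fin m ⊕ Fin n → Fin m ⊕ Fin n
  partner_partner : ∀ x, partner (partner x) = x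
  partner_ne : ∀ x, partner x ≠ x
  noncrossing : ∀ x y, ¬ (bdPos x < bdPos y ∧ bdPos y < bdPos (partner x) ∧
    bdPos (partner x) < bdPos (partner y))

theorem two_mul_zmod (x : ZMod 2) : x + x = 0 := CharTwo.add_self_eq_zero x

theorem sum_crossing_eq_zero {m n : ℕ} (D : Diagram m n) (p q : Fin m ⊕ Fin n → ZMod 2)
    (hp : ∀ u, p (D.partner u) = p u) (hq : ∀ u, q (D.partner u) = q u)
    (hpq : ∀ u, p u * q u = 0) :
    ∑ u, ∑ v, p u * q v * (if bdPos u < bdPos v then 1 else 0) = 0 := by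
  rw [sum_comm]
  refine sum_involution (fun v _ => D.partner v) ?_ (fun v _ _ => D.partner_ne v)
    (fun v _ => mem_univ _) (fun v _ => D.partner_partner v)
  intro v _
  rw [← sum_add_distrib]
  refine sum_involution (fun u _ => D.partner u) ?_ (fun v _ _ => D.partner_ne v)
    (fun v _ => mem_univ _) (fun v _ => D.partner_partner v)
  intro u _
  rw [hp, hq]
  by_cases huv : p u * q v = 0
  · simp [huv]
  have h1 : u ≠ v := by rintro rfl; exact huv (hpq u)
  have h2 : D.partner u ≠ v := by
    rintro rfl; apply huv; rw [hq]; exact hpq u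
  have h3 : D.partner v ≠ u := by
    rintro rfl; exact h2 (D.partner_partner _)
  have h4 : D.partner u ≠ D.partner v := by
    intro h; apply h1; rw [← D.partner_partner u, h, D.partner_partner]
  have n1 := bdPos_inj.ne h1
  have n2 := bdPos_inj.ne h2
  have n3 := bdPos_inj.ne h3
  have n4 := bdPos_inj.ne h4
  have n5 := bdPos_inj.ne (D.partner_ne u)
  have n6 := bdPos_inj.ne (D.partner_ne v)
  have a1 := D.noncrossing u v
  have a2 := D.noncrossing v u
  have a3 := D.noncrossing u (D.partner v)
  have a4 := D.noncrossing (D.partner v) u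
  have a5 := D.noncrossing (D.partner u) v
  have a6 := D.noncrossing v (D.partner u)
  have a7 := D.noncrossing (D.partner u) (D.partner v)
  have a8 := D.noncrossing (D.partner v) (D.partner u)
  simp only [D.partner_partner] at a1 a2 a3 a4 a5 a6 a7 a8
  rw [← mul_add, ← mul_add, ← mul_add]
  suffices h : ((((if bdPos u < bdPos v then 1 else 0) +
      if bdPos u < bdPos (D.partner v) then 1 else 0) +
      ((if bdPos (D.partner u) < bdPos v then 1 else 0) +
        if bdPos (D.partner u) < bdPos (D.partner v) then 1 else 0)) : ZMod 2) = 0 by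
    rw [h, mul_zero]
  generalize bdPos u = x at *
  generalize bdPos v = y at *
  generalize bdPos (D.partner u) = x' at *
  generalize bdPos (D.partner v) = y' at *
  split_ifs <;> first | decide | (exfalso; omega)

/-- Weighted number modulo 2 of pairs `i < j`. -/
def invSum {k : ℕ} (p q : Fin k → ZMod 2) : ZMod 2 :=
  ∑ i, ∑ j, p i * q j * (if i < j then 1 else 0)

theorem invSum_add {k : ℕ} (p q : Fin k → ZMod 2) (h : ∀ i, p i * q i = 0) :
    invSum p q + invSum q p = (∑ i, p i) * ∑ j, q j := by
  have : invSum q p = ∑ i, ∑ j, p i * q j * (if j < i then 1 else 0) := by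
    rw [invSum, sum_comm]
    refine sum_congr rfl fun i _ => sum_congr rfl fun j _ => ?_
    rw [mul_comm (q j)]
  rw [this, invSum, ← sum_add_distrib, sum_mul_sum]
  refine sum_congr rfl fun i _ => ?_
  rw [← sum_add_distrib]
  refine sum_congr rfl fun j _ => ?_
  rcases lt_trichotomy i j with hij | rfl | hij
  · simp [hij, hij.not_gt]
  · simp [h]
  · simp [hij, hij.not_gt]

theorem sum_bd {m n : ℕ} (p q : Fin m ⊕ Fin n → ZMod 2) :
    ∑ u, ∑ v, p u * q v * (if bdPos u < bdPos v then 1 else 0) =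
      invSum (fun i => p (Sum.inl i)) (fun i => q (Sum.inl i)) +
      (∑ i, p (Sum.inl i)) * (∑ j, q (Sum.inr j)) +
      invSum (fun i => q (Sum.inr i)) (fun i => p (Sum.inr i)) := by
  have h1 : ∀ i j : Fin m, bdPos (Sum.inl i : Fin m ⊕ Fin n) < bdPos (Sum.inl j : Fin m ⊕ Fin n)
      ↔ i < j := fun i j => Iff.rfl
  have h2 : ∀ (i : Fin m) (j : Fin n), bdPos (Sum.inl i : Fin m ⊕ Fin n) <
      bdPos (Sum.inr j : Fin m ⊕ Fin n) ↔ True := by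
    intro i j; simp only [bdPos, iff_true]; omega
  have h3 : ∀ (i : Fin n) (j : Fin m), bdPos (Sum.inr i : Fin m ⊕ Fin n) <
      bdPos (Sum.inl j : Fin m ⊕ Fin n) ↔ False := by
    intro i j; simp only [bdPos, iff_false]; omega
  have h4 : ∀ i j : Fin n, bdPos (Sum.inr i : Fin m ⊕ Fin n) < bdPos (Sum.inr j : Fin m ⊕ Fin n)
      ↔ j < i := by
    intro i j; simp only [bdPos, Fin.lt_def]; omega
  have h5 : invSum (fun i => q (Sum.inr i)) (fun i => p (Sum.inr i)) =
      ∑ i, ∑ j, p (Sum.inr i) * q (Sum.inr j) * (if j < i then 1 else 0) := by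
    rw [invSum, sum_comm]
    refine sum_congr rfl fun i _ => sum_congr rfl fun j _ => ?_
    rw [mul_comm (q _)]
  simp only [Fintype.sum_sum_type, h1, h2, h3, h4, h5, if_true, if_false, mul_zero, mul_one,
    sum_const_zero, sum_add_distrib, sum_mul_sum]
  rw [invSum]
  ring

theorem sum_delta {X : Type*} [Fintype X] [DecidableEq X] (x x' y y' : X) (F : X → X → ZMod 2) :
    ∑ u, ∑ v, ((if u = x then 1 else 0) + (if u = x' then 1 else 0)) *
      ((if v = y then 1 else 0) + (if v = y' then 1 else 0)) * F u v =
      F x y + F x y' + (F x' y + F x' y') := by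
  simp [add_mul, mul_add, sum_add_distrib, add_comm, add_left_comm]

theorem sum_partner {m n : ℕ} (D : Diagram m n) (p : Fin m ⊕ Fin n → ZMod 2)
    (hp : ∀ u, p (D.partner u) = p u) : ∑ i, p (Sum.inl i) = ∑ j, p (Sum.inr j) := by
  have : ∑ u, p u = 0 := by
    refine sum_involution (fun v _ => D.partner v) ?_ (fun v _ _ => D.partner_ne v)
      (fun v _ => mem_univ _) (fun v _ => D.partner_partner v)
    intro v _
    rw [hp, two_mul_zmod]
  rw [Fintype.sum_sum_type] at this
  exact CharTwo.add_eq_zero.1 this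

namespace Diagram
variable {l m n k : ℕ}

theorem exists_partner (D : Diagram l m) (D' : Diagram m n) (u : Fin l ⊕ Fin n) :
    ∃! v, v ≠ u ∧ EqvGen (glueAdj D.partner D'.partner) (gOuter u) (gOuter v) :=
  exists_glue_partner D.partner_partner D.partner_ne D'.partner_partner D'.partner_ne u

/-- The other end of the path that starts at the outer node `u` in the picture obtained by placing
`D` to the left of `D'`. -/
noncomputable def compPartner (D : Diagram l m) (D' : Diagram m n) (u : Fin l ⊕ Fin n) :
    Fin l ⊕ Fin n := (D.exists_partner D' u).choose

theorem isGlue_compPartner (D : Diagram l m) (D' : Diagram m n) :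
    IsGlue D.partner D'.partner (D.compPartner D') := by
  intro u v
  have h := (D.exists_partner D' u).choose_spec
  constructor
  · intro hv
    by_cases huv : v = u
    · exact Or.inl huv
    · exact Or.inr (h.2 v ⟨huv, hv⟩)
  · rintro (rfl | rfl)
    · exact .refl _
    · exact h.1.2

theorem compPartner_ne (D : Diagram l m) (D' : Diagram m n) (u : Fin l ⊕ Fin n) :
    D.compPartner D' u ≠ u := (D.exists_partner D' u).choose_spec.1.1

theorem compPartner_compPartner (D : Diagram l m) (D' : Diagram m n) (u : Fin l ⊕ Fin n) :
    D.compPartner D' (D.compPartner D' u) = u := by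
  have h := ((D.isGlue_compPartner D' u (D.compPartner D' u)).2 (Or.inr rfl)).symm
  rcases (D.isGlue_compPartner D' _ _).1 h with h | h
  · exact absurd h.symm (D.compPartner_ne D' u)
  · exact h.symm

theorem comp_noncrossing (D : Diagram l m) (D' : Diagram m n) (x y : Fin l ⊕ Fin n) :
    ¬ (bdPos x < bdPos y ∧ bdPos y < bdPos (D.compPartner D' x) ∧
      bdPos (D.compPartner D' x) < bdPos (D.compPartner D' y)) := by
  classical
  rintro ⟨h1, h2, h3⟩
  set c := D.compPartner D' with hc
  let ind : Fin l ⊕ Fin n → Fin l ⊕ (Fin m ⊕ Fin n) → ZMod 2 := fun x z =>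
    if EqvGen (glueAdj D.partner D'.partner) (gOuter x) z then 1 else 0
  have hind : ∀ x u v, glueAdj D.partner D'.partner u v → ind x v = ind x u := by
    intro x u v huv
    have : EqvGen (glueAdj D.partner D'.partner) (gOuter x) v ↔
        EqvGen (glueAdj D.partner D'.partner) (gOuter x) u :=
      ⟨fun h => h.trans _ _ _ (EqvGen.rel _ _ huv).symm, fun h => h.trans _ _ _ (.rel _ _ huv)⟩
    simp only [ind, this]
  have hout : ∀ x v, ind x (gOuter v) = (if v = x then 1 else 0) + (if v = c x then 1 else 0) := by
    intro x v
    have hne := D.compPartner_ne D' x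
    simp only [ind, D.isGlue_compPartner D' x v, ← hc]
    by_cases h : v = x
    · have : v ≠ c x := by rw [h]; exact hne.symm
      simp [h]
      exact fun h' => absurd h'.symm hne
    · simp [h]
  have hdis : ∀ z, ind x z * ind y z = 0 := by
    intro z
    simp only [ind]
    by_cases hx : EqvGen (glueAdj D.partner D'.partner) (gOuter x) z
    · by_cases hy : EqvGen (glueAdj D.partner D'.partner) (gOuter y) z
      · rcases (D.isGlue_compPartner D' _ _).1 (hx.trans _ _ _ hy.symm) with h | h
        · rw [h] at h1; exact absurd h1 (lt_irrefl _)
        · rw [← hc] at h; rw [← h] at h2; exact absurd h2 (lt_irrefl _)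
      · simp [hy]
    · simp [hx]
  have pL : ∀ x u, ind x (gLeft (D.partner u)) = ind x (gLeft u) := fun x u =>
    hind x _ _ (Or.inl ⟨u, rfl, rfl⟩)
  have pR : ∀ x u, ind x (Sum.inr (D'.partner u)) = ind x (Sum.inr u) := fun x u =>
    hind x _ _ (Or.inr ⟨u, rfl, rfl⟩)
  have s1 := sum_crossing_eq_zero D (fun u => ind x (gLeft u)) (fun u => ind y (gLeft u)) (pL x) (pL y) (fun u => hdis _)
  have s2 := sum_crossing_eq_zero D' (fun u => ind x (Sum.inr u)) (fun u => ind y (Sum.inr u)) (pR x) (pR y) (fun u => hdis _)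
  have t1 := sum_partner D (fun u => ind x (gLeft u)) (pL x)
  have t2 := sum_partner D (fun u => ind y (gLeft u)) (pL y)
  have t3 := sum_partner D' (fun u => ind x (Sum.inr u)) (pR x)
  have t4 := sum_partner D' (fun u => ind y (Sum.inr u)) (pR y)
  have i1 := invSum_add (fun i : Fin m => ind x (Sum.inr (Sum.inl i)))
    (fun i : Fin m => ind y (Sum.inr (Sum.inl i))) (fun i => hdis _)
  have s3 := sum_bd (fun u => ind x (gOuter u)) (fun u => ind y (gOuter u))
  rw [sum_bd] at s1 s2
  simp only [Sum.map_inl, Sum.map_inr, id] at s1 s2 s3 t1 t2 t3 t4 i1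
  rw [t1, t3] at s1
  rw [t3, t4] at i1
  rw [t3] at s2
  rw [t1, t3] at s3
  have s4 : ∑ u, ∑ v, ind x (gOuter u) * ind y (gOuter v) *
      (if bdPos u < bdPos v then 1 else 0) = 0 := by
    refine s3.trans ?_
    rw [t4] at s1
    linear_combination s1 + s2 - i1 - two_mul_zmod ((∑ j : Fin n, ind x (Sum.inr (Sum.inr j))) *
      ∑ j : Fin n, ind y (Sum.inr (Sum.inr j))) + two_mul_zmod 0
  simp only [hout] at s4
  rw [sum_delta x (c x) y (c y) fun u v => if bdPos u < bdPos v then 1 else 0,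
    if_pos h1, if_pos (h1.trans (h2.trans h3)), if_neg (not_lt.2 h2.le), if_pos h3] at s4
  revert s4; decide

/-- The diagram `[D ∘ D']`: identify the right bar of `D` with the left bar of `D'`, join the arcs
and forget the closed loops. -/
noncomputable def comp (D : Diagram l m) (D' : Diagram m n) : Diagram l n where
  partner := D.compPartner D'
  partner_partner := D.compPartner_compPartner D'
  partner_ne := D.compPartner_ne D'
  noncrossing := D.comp_noncrossing D'

/-- The number of closed loops created when `D` and `D'` are composed. -/
noncomputable def loops (D : Diagram l m) (D' : Diagram m n) : ℕ := gLoops D.partner D'.partner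

theorem isGlue_comp (D : Diagram l m) (D' : Diagram m n) :
    IsGlue D.partner D'.partner (D.comp D').partner := D.isGlue_compPartner D'

theorem eq_comp {D : Diagram l m} {D' : Diagram m n} {D'' : Diagram l n}
    (h : ∀ u, EqvGen (glueAdj D.partner D'.partner) (gOuter u) (gOuter (D''.partner u))) :
    D.comp D' = D'' := by
  ext1
  funext u
  rcases (D.isGlue_comp D' _ _).1 (h u) with h | h
  · exact absurd h (D''.partner_ne u)
  · exact h.symm

theorem comp_assoc (D₁ : Diagram l m) (D₂ : Diagram m n) (D₃ : Diagram n k) :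
    (D₁.comp D₂).comp D₃ = D₁.comp (D₂.comp D₃) := by
  apply eq_comp
  intro u
  rw [glue_assoc (D₁.isGlue_comp D₂) (D₂.isGlue_comp D₃)]
  exact ((D₁.isGlue_comp (D₂.comp D₃)) _ _).2 (Or.inr rfl)

theorem loops_assoc (D₁ : Diagram l m) (D₂ : Diagram m n) (D₃ : Diagram n k) :
    D₁.loops D₂ + (D₁.comp D₂).loops D₃ = D₂.loops D₃ + D₁.loops (D₂.comp D₃) :=
  gLoops_assoc (D₁.isGlue_comp D₂) (D₂.isGlue_comp D₃)

/-- The identity diagram: `n` horizontal strands. -/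
def idDiagram (n : ℕ) : Diagram n n where
  partner := Sum.swap
  partner_partner := Sum.swap_swap
  partner_ne := by rintro (x | x) h <;> cases h
  noncrossing := by
    rintro (x | x) (y | y) <;> simp only [bdPos, Sum.swap_inl, Sum.swap_inr] <;> omega

theorem id_comp (D : Diagram m n) : (idDiagram m).comp D = D := by
  apply eq_comp
  have key : ∀ u : Fin m ⊕ Fin n, EqvGen (glueAdj (idDiagram m).partner D.partner)
      (gOuter u) (Sum.inr u) := by
    rintro (u | u)
    · exact .rel _ _ (Or.inl ⟨Sum.inl u, rfl, rfl⟩)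
    · exact .refl _
  intro u
  exact ((key u).trans _ _ _ (.rel _ _ (Or.inr ⟨u, rfl, rfl⟩))).trans _ _ _ (key _).symm

theorem comp_id (D : Diagram m n) : D.comp (idDiagram n) = D := by
  apply eq_comp
  have key : ∀ u : Fin m ⊕ Fin n, EqvGen (glueAdj D.partner (idDiagram n).partner)
      (gOuter u) (gLeft u) := by
    rintro (u | u)
    · exact .refl _
    · exact .rel _ _ (Or.inr ⟨Sum.inr u, rfl, rfl⟩)
  intro u
  exact ((key u).trans _ _ _ (.rel _ _ (Or.inl ⟨u, rfl, rfl⟩))).trans _ _ _ (key _).symm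

theorem gLoops_eq_zero {A B C : Type*} {f : A ⊕ B → A ⊕ B} {g : B ⊕ C → B ⊕ C}
    (h : ∀ b : B, ∃ u : A ⊕ C, EqvGen (glueAdj f g) (gOuter u) (Sum.inr (Sum.inl b))) :
    gLoops f g = 0 := by
  have : classesIn (glueAdj f g) (Set.range fun b : B => Sum.inr (Sum.inl b)) = ∅ := by
    rw [Set.eq_empty_iff_forall_notMem]
    rintro _ ⟨⟨x, rfl⟩, hs⟩
    obtain ⟨b, rfl⟩ := hs (EqvGen.refl x)
    obtain ⟨u, hu⟩ := h b
    obtain ⟨b', hb'⟩ := hs hu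
    rcases u with u | u <;> simp at hb'
  rw [gLoops, this, Set.ncard_empty]

theorem loops_id_left (D : Diagram m n) : (idDiagram m).loops D = 0 :=
  gLoops_eq_zero fun b => ⟨Sum.inl b, .rel _ _ (Or.inl ⟨Sum.inl b, rfl, rfl⟩)⟩

theorem loops_id_right (D : Diagram m n) : D.loops (idDiagram n) = 0 :=
  gLoops_eq_zero fun b => ⟨Sum.inr b, .symm _ _ (.rel _ _ (Or.inr ⟨Sum.inl b, rfl, rfl⟩))⟩

theorem eq_id_of_no_left_cup (D : Diagram n n)
    (h : ∀ i j, D.partner (Sum.inl i) ≠ Sum.inl j) : D = idDiagram n := by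
  have h' : ∀ i, ∃ j, D.partner (Sum.inl i) = Sum.inr j := by
    intro i
    rcases hi : D.partner (Sum.inl i) with j | j
    · exact absurd hi (h i j)
    · exact ⟨j, rfl⟩
  choose s hs using h'
  have hmono : StrictMono s := by
    intro i j hij
    by_contra hlt
    have hne : s i ≠ s j := by
      intro he
      have := congrArg D.partner ((hs i).trans ((congrArg Sum.inr he).trans (hs j).symm))
      rw [D.partner_partner, D.partner_partner] at this
      exact hij.ne (Sum.inl_injective this)
    have := D.noncrossing (Sum.inl i) (Sum.inl j)
    rw [hs, hs] at this
    simp only [bdPos] at this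
    rw [Fin.lt_def] at hij hlt
    rw [Ne, Fin.ext_iff] at hne
    omega
  have hid : s = id := by
    have := Subsingleton.elim (hmono.orderIsoOfSurjective s
      (Finite.surjective_of_injective hmono.injective)) (OrderIso.refl _)
    funext i
    exact congrArg (fun e : Fin n ≃o Fin n => e i) this
  ext1
  funext x
  rcases x with i | i
  · rw [hs, hid]; rfl
  · have := hs i
    rw [hid] at this
    rw [← show D.partner (Sum.inl i) = Sum.inr i from this, D.partner_partner,
      show D.partner (Sum.inl i) = Sum.inr i from this]
    rfl

theorem comp_eq_id_iff (D D' : Diagram n n) :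
    D.comp D' = idDiagram n ↔ D = idDiagram n ∧ D' = idDiagram n := by
  constructor
  · intro h
    have hD : D = idDiagram n := by
      apply eq_id_of_no_left_cup
      intro i j hij
      have h1 : EqvGen (glueAdj D.partner D'.partner) (gOuter (Sum.inl i)) (gOuter (Sum.inl j)) :=
        .rel _ _ (Or.inl ⟨Sum.inl i, rfl, by rw [hij]; rfl⟩)
      rcases (D.isGlue_comp D' _ _).1 h1 with h2 | h2
      · exact D.partner_ne (Sum.inl i) (hij.trans h2)
      · rw [h] at h2; cases h2
    refine ⟨hD, ?_⟩
    rw [hD, id_comp] at h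
    exact h
  · rintro ⟨rfl, rfl⟩
    exact id_comp _
end Diagram
end

/-! ### The Temperley--Lieb category, algebras and modules -/

section
universe u
open CategoryTheory TensorProduct MulOpposite

section Hom
variable (R : Type u) [CommRing R]

/-- The morphism module `TL(m, n)` of the Temperley--Lieb category with parameter `a`: the free
`R`-module on all `(m, n)`-diagrams. -/
def TLHom (_a : R) (m n : ℕ) : Type u := Diagram m n →₀ R

variable {R} (a : R) {k l m n : ℕ}

noncomputable instance : AddCommGroup (TLHom R a m n) :=
  inferInstanceAs (AddCommGroup (Diagram m n →₀ R))
noncomputable instance : Module R (TLHom R a m n) :=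
  inferInstanceAs (Module R (Diagram m n →₀ R))

/-- The basis element given by a diagram. -/
noncomputable def TLHom.of (D : Diagram m n) : TLHom R a m n := Finsupp.single D (1 : R)

/-- Composition in the Temperley--Lieb category: `D ⊗ D' ↦ a ^ k • [D ∘ D']`, where `k` is the
number of closed loops created. -/
noncomputable def TLHom.comp :
    TLHom R a l m →ₗ[R] TLHom R a m n →ₗ[R] TLHom R a l n :=
  Finsupp.linearCombination R fun D : Diagram l m =>
    Finsupp.linearCombination R fun D' : Diagram m n =>
      a ^ D.loops D' • TLHom.of a (D.comp D')

variable {a}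

theorem TLHom.comp_of (D : Diagram l m) (D' : Diagram m n) :
    TLHom.comp a (TLHom.of a D) (TLHom.of a D') = a ^ D.loops D' • TLHom.of a (D.comp D') := by
  unfold TLHom.comp TLHom.of
  erw [Finsupp.linearCombination_single, one_smul, Finsupp.linearCombination_single, one_smul]

theorem TLHom.hom_ext {M : Type*} [AddCommMonoid M] [Module R M] {f g : TLHom R a m n →ₗ[R] M}
    (h : ∀ D, f (TLHom.of a D) = g (TLHom.of a D)) : f = g :=
  Finsupp.lhom_ext' fun D => LinearMap.ext_ring (h D)

theorem TLHom.comp_assoc (x : TLHom R a k l) (y : TLHom R a l m) (z : TLHom R a m n) :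
    comp a (comp a x y) z = comp a x (comp a y z) := by
  have : (comp a).compr₂ (comp a) =
      ((LinearMap.llcomp R (TLHom R a m n) (TLHom R a l n) (TLHom R a k n)).flip ∘ₗ
        (comp a : TLHom R a l m →ₗ[R] TLHom R a m n →ₗ[R] TLHom R a l n)).flip ∘ₗ
          (comp a : TLHom R a k l →ₗ[R] TLHom R a l n →ₗ[R] TLHom R a k n) := by
    refine hom_ext fun D₁ => hom_ext fun D₂ => hom_ext fun D₃ => ?_
    change comp a (comp a (of a D₁) (of a D₂)) (of a D₃) =
      comp a (of a D₁) (comp a (of a D₂) (of a D₃))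
    rw [comp_of, comp_of, map_smul, map_smul, LinearMap.smul_apply, comp_of, comp_of, smul_smul,
      smul_smul, ← pow_add, ← pow_add, Diagram.loops_assoc, Diagram.comp_assoc]
  exact LinearMap.congr_fun (LinearMap.congr_fun (LinearMap.congr_fun this x) y) z

theorem TLHom.id_comp (x : TLHom R a m n) : comp a (of a (Diagram.idDiagram m)) x = x := by
  have : comp a (of a (Diagram.idDiagram m)) = (LinearMap.id : TLHom R a m n →ₗ[R] _) := by
    refine hom_ext fun D => ?_
    rw [comp_of, Diagram.loops_id_left, Diagram.id_comp, pow_zero, one_smul]; rfl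
  rw [this]; rfl

theorem TLHom.comp_id (x : TLHom R a m n) : comp a x (of a (Diagram.idDiagram n)) = x := by
  have : (comp a).flip (of a (Diagram.idDiagram n)) = (LinearMap.id : TLHom R a m n →ₗ[R] _) := by
    refine hom_ext fun D => ?_
    rw [LinearMap.flip_apply, comp_of, Diagram.loops_id_right, Diagram.comp_id, pow_zero, one_smul]
    rfl
  exact LinearMap.congr_fun this x

variable (R) in
/-- The Temperley--Lieb algebra `TL_n(R, a) = TL(n, n)`. -/
def TLAlg (a : R) (n : ℕ) : Type u := TLHom R a n n

noncomputable instance : AddCommGroup (TLAlg R a n) := inferInstanceAs (AddCommGroup (TLHom R a n n))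
noncomputable instance : Module R (TLAlg R a n) := inferInstanceAs (Module R (TLHom R a n n))

noncomputable instance : Ring (TLAlg R a n) where
  __ := (inferInstance : AddCommGroup (TLAlg R a n))
  mul x y := TLHom.comp a x y
  one := TLHom.of a (Diagram.idDiagram n)
  mul_assoc := TLHom.comp_assoc
  one_mul := TLHom.id_comp
  mul_one := TLHom.comp_id
  left_distrib x y z := map_add (TLHom.comp a x) y z
  right_distrib x y z := LinearMap.map_add₂ (TLHom.comp a) x y z
  zero_mul x := LinearMap.map_zero₂ (TLHom.comp a) x
  mul_zero x := map_zero (TLHom.comp a x)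

noncomputable instance : Algebra R (TLAlg R a n) :=
  Algebra.ofModule (fun r x y => LinearMap.map_smul₂ (TLHom.comp a) r x y)
    (fun r x y => map_smul (TLHom.comp a x) r y)

/-- The left action of `TL_m` on `TL(m, n)` by composition. -/
noncomputable instance : Module (TLAlg R a m) (TLHom R a m n) where
  smul x y := TLHom.comp a x y
  mul_smul := TLHom.comp_assoc
  one_smul := TLHom.id_comp
  smul_zero x := map_zero (TLHom.comp a x)
  zero_smul x := LinearMap.map_zero₂ (TLHom.comp a) x
  smul_add x y z := map_add (TLHom.comp a x) y z
  add_smul x y z := LinearMap.map_add₂ (TLHom.comp a) x y z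

instance : IsScalarTower R (TLAlg R a m) (TLHom R a m n) where
  smul_assoc r x y := LinearMap.map_smul₂ (TLHom.comp a) r x y

/-- The right action of `TL_n` on `TL(m, n)` by composition. -/
noncomputable instance : Module (TLAlg R a n)ᵐᵒᵖ (TLHom R a m n) where
  smul x y := TLHom.comp a y (unop x)
  mul_smul x y z := (TLHom.comp_assoc z (unop y) (unop x)).symm
  one_smul := TLHom.comp_id
  smul_zero x := LinearMap.map_zero₂ (TLHom.comp a) (unop x)
  zero_smul x := map_zero (TLHom.comp a x)
  smul_add x y z := LinearMap.map_add₂ (TLHom.comp a) y z (unop x)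
  add_smul x y z := map_add (TLHom.comp a z) (unop x) (unop y)

instance : IsScalarTower R (TLAlg R a n)ᵐᵒᵖ (TLHom R a m n) where
  smul_assoc r x y := map_smul (TLHom.comp a y) r (unop x)

open Classical in
/-- The linear map sending the identity diagram to `1` and every other diagram to `0`. -/
noncomputable def TLHom.counit (a : R) (n : ℕ) : TLHom R a n n →ₗ[R] R :=
  Finsupp.linearCombination R fun D : Diagram n n => if D = Diagram.idDiagram n then (1 : R) else 0

open Classical in
theorem TLHom.counit_of (D : Diagram n n) :
    TLHom.counit a n (TLHom.of a D) = if D = Diagram.idDiagram n then (1 : R) else 0 := by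
  unfold TLHom.counit TLHom.of
  erw [Finsupp.linearCombination_single, one_smul]

theorem TLHom.counit_comp (x y : TLHom R a n n) :
    counit a n (comp a x y) = counit a n x * counit a n y := by
  classical
  have : (TLHom.comp a).compr₂ (TLHom.counit a n) =
      (LinearMap.mul R R).compl₁₂ (TLHom.counit a n) (TLHom.counit a n) := by
    refine TLHom.hom_ext fun D => TLHom.hom_ext fun D' => ?_
    change TLHom.counit a n (TLHom.comp a (TLHom.of a D) (TLHom.of a D')) =
      TLHom.counit a n (TLHom.of a D) * TLHom.counit a n (TLHom.of a D')
    rw [TLHom.comp_of, map_smul, counit_of, counit_of, counit_of]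
    by_cases h : D.comp D' = Diagram.idDiagram n
    · obtain ⟨rfl, rfl⟩ := (Diagram.comp_eq_id_iff _ _).1 h
      rw [if_pos h, Diagram.loops_id_left]
      simp
    · rw [if_neg h, smul_zero]
      rw [Diagram.comp_eq_id_iff, not_and_or] at h
      rcases h with h | h <;> simp [h]
  exact LinearMap.congr_fun (LinearMap.congr_fun this x) y

/-- The augmentation of the Temperley--Lieb algebra: it sends the identity diagram to `1` and every
other diagram to `0`. -/
noncomputable def TLAlg.augmentation (a : R) (n : ℕ) : TLAlg R a n →ₐ[R] R :=
  AlgHom.ofLinearMap (TLHom.counit a n : TLHom R a n n →ₗ[R] R)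
    ((TLHom.counit_of _).trans (if_pos rfl)) TLHom.counit_comp

/-- The trivial right `TL_n`-module `R`, on which `TL_n` acts through the augmentation: every diagram
other than the identity acts by zero. -/
def TLTriv (_a : R) (_n : ℕ) : Type u := R

noncomputable instance : AddCommGroup (TLTriv a n) := inferInstanceAs (AddCommGroup R)
noncomputable instance : Module R (TLTriv a n) := inferInstanceAs (Module R R)

noncomputable instance : Module (TLAlg R a n)ᵐᵒᵖ (TLTriv a n) where
  smul x r := TLAlg.augmentation a n (unop x) • r
  mul_smul x y r := by
    change TLAlg.augmentation a n (unop y * unop x) • r =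
      TLAlg.augmentation a n (unop x) • TLAlg.augmentation a n (unop y) • r
    rw [map_mul, mul_comm, mul_smul]
  one_smul r := by
    change TLAlg.augmentation a n 1 • r = r
    rw [map_one, one_smul]
  smul_zero x := smul_zero (TLAlg.augmentation a n (unop x))
  zero_smul r := by
    change TLAlg.augmentation a n 0 • r = 0
    rw [map_zero, zero_smul]
  smul_add x r s := smul_add (TLAlg.augmentation a n (unop x)) r s
  add_smul x y r := by
    change TLAlg.augmentation a n (unop x + unop y) • r =
      TLAlg.augmentation a n (unop x) • r + TLAlg.augmentation a n (unop y) • r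
    rw [map_add, add_smul]

instance : IsScalarTower R (TLAlg R a n)ᵐᵒᵖ (TLTriv a n) where
  smul_assoc r x s := by
    change TLAlg.augmentation a n (r • unop x) • s = r • TLAlg.augmentation a n (unop x) • s
    rw [map_smul, smul_assoc]

/-- The diagram has an arc joining two nodes on the right bar. -/
def Diagram.HasRightCup (D : Diagram m n) : Prop :=
  ∃ i j, D.partner (Sum.inr i) = Sum.inr j

/-- The left submodule of `TL(m, n)` generated by the diagrams having a right cup. -/
noncomputable def rightCupSubmodule (a : R) (m n : ℕ) : Submodule (TLAlg R a m) (TLHom R a m n) :=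
  Submodule.span (TLAlg R a m) {x | ∃ D : Diagram m n, D.HasRightCup ∧ x = TLHom.of a D}

/-- The cell module `S(m, n) = TL(m, n) / {diagrams having a right cup}`, a left `TL_m`-module. -/
abbrev CellModule (a : R) (m n : ℕ) : Type u := TLHom R a m n ⧸ rightCupSubmodule a m n

end Hom

/-! ### Tor over a noncommutative algebra -/

section Tor
variable (R : Type u) [CommRing R] (A : Type u) [Ring A] [Algebra R A]
  (M : Type u) [AddCommGroup M] [Module R M] [Module Aᵐᵒᵖ M] [IsScalarTower R Aᵐᵒᵖ M]

/-- The relations `m b ⊗ n = m ⊗ b n`. -/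
def balancedRel (N : Type u) [AddCommGroup N] [Module A N] : Submodule R (M ⊗[ℤ] N) :=
  Submodule.span R {x | ∃ (m : M) (b : A) (n : N), x = (op b • m) ⊗ₜ[ℤ] n - m ⊗ₜ[ℤ] (b • n)}

/-- The tensor product `M ⊗_A N` of a right and a left `A`-module, with its `R`-module structure. -/
abbrev BalancedTensor (N : Type u) [AddCommGroup N] [Module A N] : Type u :=
  (M ⊗[ℤ] N) ⧸ balancedRel R A M N

/-- The map `M ⊗_A f`. -/
def BalancedTensor.map {N N' : Type u} [AddCommGroup N] [Module A N] [AddCommGroup N']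
    [Module A N'] (f : N →ₗ[A] N') : BalancedTensor R A M N →ₗ[R] BalancedTensor R A M N' :=
  Submodule.mapQ _ _
    (TensorProduct.AlgebraTensorModule.map (LinearMap.id : M →ₗ[R] M) f.toAddMonoidHom.toIntLinearMap)
    (by
      rw [balancedRel, Submodule.span_le]
      rintro _ ⟨m, b, n, rfl⟩
      refine Submodule.subset_span ⟨m, b, f n, ?_⟩
      simp)

theorem BalancedTensor.hom_ext {N P : Type u} [AddCommGroup N] [Module A N] [AddCommGroup P]
    [Module R P] {f g : BalancedTensor R A M N →ₗ[R] P}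
    (h : ∀ m n, f (Submodule.Quotient.mk (m ⊗ₜ[ℤ] n)) = g (Submodule.Quotient.mk (m ⊗ₜ[ℤ] n))) :
    f = g := by
  refine LinearMap.ext fun x => ?_
  obtain ⟨x, rfl⟩ := Submodule.Quotient.mk_surjective _ x
  induction x with
  | zero => simp
  | add x y hx hy => rw [Submodule.Quotient.mk_add, map_add, map_add, hx, hy]
  | tmul x y => exact h x y

/-- The functor `M ⊗_A -` from left `A`-modules to `R`-modules. -/
noncomputable def tensorFunctor : ModuleCat.{u} A ⥤ ModuleCat.{u} R where
  obj N := ModuleCat.of R (BalancedTensor R A M N)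
  map f := ModuleCat.ofHom (BalancedTensor.map R A M f.hom)
  map_id _ := ModuleCat.hom_ext (BalancedTensor.hom_ext R A M fun _ _ => rfl)
  map_comp _ _ := ModuleCat.hom_ext (BalancedTensor.hom_ext R A M fun _ _ => rfl)

instance : (tensorFunctor R A M).Additive where
  map_add {N N' f g} := by
    refine ModuleCat.hom_ext (BalancedTensor.hom_ext R A M fun m n => ?_)
    change Submodule.Quotient.mk (m ⊗ₜ[ℤ] (f.hom n + g.hom n)) =
      (Submodule.Quotient.mk (m ⊗ₜ[ℤ] (f.hom n) + m ⊗ₜ[ℤ] (g.hom n)) : BalancedTensor R A M N')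
    rw [TensorProduct.tmul_add]

/-- `Tor_q^A(M, N)`, the value at `N` of the `q`-th left derived functor of `M ⊗_A -`. -/
noncomputable def TorModule (q : ℕ) (N : Type u) [AddCommGroup N] [Module A N] : ModuleCat.{u} R :=
  ((tensorFunctor R A M).leftDerived q).obj (ModuleCat.of A N)
end Tor

/-! ### The two-sided bar construction -/

section Bar
variable (R : Type u) [CommRing R] (A : Type u) [Ring A] [Algebra R A]

/-- A left `A`-module together with the underlying `R`-module structure. -/
structure AlgMod where
  carrier : Type u
  [addCommGroup : AddCommGroup carrier]
  [module : Module R carrier]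
  [algModule : Module A carrier]
  [isScalarTower : IsScalarTower R A carrier]

instance : CoeSort (AlgMod R A) (Type u) := ⟨AlgMod.carrier⟩
attribute [instance] AlgMod.addCommGroup AlgMod.module AlgMod.algModule AlgMod.isScalarTower

variable {R A}

/-- The left `A`-module `A ⊗_R T`. -/
abbrev AlgMod.free (T : AlgMod R A) : AlgMod R A := { carrier := A ⊗[R] T.carrier }

/-- The action map `b ⊗ t ↦ b t`. -/
noncomputable def actMap (T : AlgMod R A) : T.free.carrier →ₗ[A] T.carrier :=
  TensorProduct.AlgebraTensorModule.lift
    { toFun := fun b => Algebra.lsmul R R T.carrier b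
      map_add' := map_add _
      map_smul' := map_mul _ }

theorem actMap_tmul (T : AlgMod R A) (b : A) (t : T.carrier) : actMap T (b ⊗ₜ t) = b • t := rfl

/-- From `d : A ⊗ T → T`, the map `A ⊗ A ⊗ T → A ⊗ T`, `b ⊗ t ↦ b t - b ⊗ d t`. -/
noncomputable def nextD (T : AlgMod R A) (d : T.free.carrier →ₗ[A] T.carrier) :
    T.free.free.carrier →ₗ[A] T.free.carrier :=
  actMap T.free - LinearMap.baseChange A (d.restrictScalars R)

theorem nextD_tmul (T : AlgMod R A) (d : T.free.carrier →ₗ[A] T.carrier) (b : A)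
    (t : T.free.carrier) : nextD T d (b ⊗ₜ[R] t) = b • t - b ⊗ₜ[R] d t := rfl

/-- `A^{⊗ q} ⊗_R X`. -/
def barTerm (X : AlgMod R A) : ℕ → AlgMod R A
  | 0 => X
  | q + 1 => (barTerm X q).free

/-- The differential `A^{⊗ (q + 1)} ⊗ X → A^{⊗ q} ⊗ X` of the augmented bar resolution,
`(b₀ | b₁ | … | b_q | x) ↦ ∑ᵢ (-1)ⁱ (b₀ | … | bᵢ bᵢ₊₁ | … | x)`. -/
noncomputable def barResolutionD (X : AlgMod R A) :
    (q : ℕ) → (barTerm X q).free.carrier →ₗ[A] (barTerm X q).carrier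
  | 0 => actMap X
  | q + 1 => nextD (barTerm X q) (barResolutionD X q)

variable {M : Type u} [AddCommGroup M] [Module R M] [Module Aᵐᵒᵖ M] [IsScalarTower R Aᵐᵒᵖ M]

variable (R A M) in
/-- The right action map `m ⊗ b ↦ m b`. -/
noncomputable def rightActMap : M ⊗[R] A →ₗ[R] M :=
  TensorProduct.lift (LinearMap.mk₂ R (fun m b => op b • m)
    (fun m m' b => smul_add (op b) m m')
    (fun r m b => by
      rw [← algebraMap_smul Aᵐᵒᵖ r m, ← algebraMap_smul Aᵐᵒᵖ r (op b • m), smul_smul, smul_smul,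
        Algebra.commutes])
    (fun m b b' => by rw [MulOpposite.op_add, add_smul])
    (fun r m b => by rw [op_smul, smul_assoc]))

theorem rightActMap_tmul (m : M) (b : A) : rightActMap R A M (m ⊗ₜ b) = op b • m := rfl

variable (M) in
/-- The map `M ⊗ A ⊗ T → M ⊗ T`, `m ⊗ b ⊗ t ↦ m b ⊗ t - m ⊗ d (b ⊗ t)`. -/
noncomputable def twoSidedD (T : AlgMod R A) (d : T.free.carrier →ₗ[A] T.carrier) :
    M ⊗[R] T.free.carrier →ₗ[R] M ⊗[R] T.carrier :=
  (rightActMap R A M).rTensor T.carrier ∘ₗ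
      (TensorProduct.assoc R M A T.carrier).symm.toLinearMap -
    (d.restrictScalars R).lTensor M

theorem twoSidedD_tmul (T : AlgMod R A) (d : T.free.carrier →ₗ[A] T.carrier) (m : M) (b : A)
    (t : T.carrier) : twoSidedD M T d (m ⊗ₜ[R] (b ⊗ₜ[R] t)) =
      (op b • m) ⊗ₜ[R] t - m ⊗ₜ[R] d (b ⊗ₜ[R] t) := rfl

theorem comp_nextD_actMap (T : AlgMod R A) (t : T.free.free.carrier) :
    actMap T (nextD T (actMap T) t) = 0 := by
  induction t using TensorProduct.induction_on with
  | zero => simp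
  | add x y hx hy => rw [map_add, map_add, hx, hy, add_zero]
  | tmul b t => rw [nextD_tmul, map_sub, map_smul, actMap_tmul, sub_self]

theorem nextD_nextD (T : AlgMod R A) (d : T.free.carrier →ₗ[A] T.carrier)
    (h : ∀ t, d (nextD T d t) = 0) (t : T.free.free.free.carrier) :
    nextD T d (nextD T.free (nextD T d) t) = 0 := by
  induction t using TensorProduct.induction_on with
  | zero => simp
  | add x y hx hy => rw [map_add, map_add, hx, hy, add_zero]
  | tmul b t =>
    rw [nextD_tmul, map_sub, map_smul, nextD_tmul, h, TensorProduct.tmul_zero, sub_zero, sub_self]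

theorem barResolutionD_comp (X : AlgMod R A) (q : ℕ) (t : (barTerm X q).free.free.carrier) :
    barResolutionD X q (nextD _ (barResolutionD X q) t) = 0 := by
  induction q with
  | zero => exact comp_nextD_actMap X t
  | succ q ih => exact nextD_nextD _ _ ih t

theorem twoSidedD_comp (T : AlgMod R A) (d : T.free.carrier →ₗ[A] T.carrier)
    (h : ∀ t, d (nextD T d t) = 0) (t : M ⊗[R] T.free.free.carrier) :
    twoSidedD M T d (twoSidedD M T.free (nextD T d) t) = 0 := by
  induction t using TensorProduct.induction_on with
  | zero => simp
  | add x y hx hy => rw [map_add, map_add, hx, hy, add_zero]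
  | tmul m t =>
    induction t using TensorProduct.induction_on with
    | zero => simp
    | add x y hx hy => rw [TensorProduct.tmul_add, map_add, map_add, hx, hy, add_zero]
    | tmul b t =>
      have key : ∀ (m : M) (b : A) (t : T.free.carrier), twoSidedD M T d (m ⊗ₜ[R] (b • t)) =
          twoSidedD M T d ((op b • m) ⊗ₜ[R] t) + (op b • m) ⊗ₜ[R] d t - m ⊗ₜ[R] (b • d t) := by
        intro m b t
        induction t using TensorProduct.induction_on with
        | zero => simp
        | add x y hx hy =>
          simp only [smul_add, TensorProduct.tmul_add, map_add, hx, hy]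
          abel
        | tmul c t =>
          have hd : d ((b * c) ⊗ₜ[R] t) = b • d (c ⊗ₜ[R] t) := map_smul d b (c ⊗ₜ[R] t)
          rw [TensorProduct.smul_tmul', twoSidedD_tmul, twoSidedD_tmul, smul_eq_mul, op_mul,
            mul_smul, hd]
          abel
      have h1 : b • d t = d (b ⊗ₜ[R] d t) := by
        have := h (b ⊗ₜ[R] t)
        rwa [nextD_tmul, map_sub, map_smul, sub_eq_zero] at this
      rw [twoSidedD_tmul, map_sub, nextD_tmul, TensorProduct.tmul_sub, map_sub, key,
        twoSidedD_tmul, h1]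
      abel

theorem aug_comp (X : AlgMod R A) {Y : Type u} [AddCommGroup Y] [Module R Y]
    (φ : M ⊗[R] X.carrier →ₗ[R] Y)
    (hφ : ∀ (m : M) (b : A) (x : X.carrier), φ ((op b • m) ⊗ₜ x) = φ (m ⊗ₜ (b • x)))
    (t : M ⊗[R] X.free.carrier) : φ (twoSidedD M X (actMap X) t) = 0 := by
  induction t using TensorProduct.induction_on with
  | zero => simp
  | add x y hx hy => rw [map_add, map_add, hx, hy, add_zero]
  | tmul m t =>
    induction t using TensorProduct.induction_on with
    | zero => simp
    | add x y hx hy => rw [TensorProduct.tmul_add, map_add, map_add, hx, hy, add_zero]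
    | tmul b t => rw [twoSidedD_tmul, map_sub, actMap_tmul, hφ, sub_self]

/-- The cone of `Bar(M, A, X) → M ⊗_A X → Y`, where the second map is induced by the balanced map
`φ`. In degree `0` it is `Y`, in degree `q + 1` it is `M ⊗ A^{⊗ q} ⊗ X`, and the differential is the
alternating sum (starting with sign `+`) of the maps multiplying two neighbouring tensor factors; in
degree `1` it is `φ`. -/
noncomputable def barCone (X : AlgMod R A) (Y : Type u) [AddCommGroup Y] [Module R Y]
    (φ : M ⊗[R] X.carrier →ₗ[R] Y)
    (hφ : ∀ (m : M) (b : A) (x : X.carrier), φ ((op b • m) ⊗ₜ x) = φ (m ⊗ₜ (b • x))) :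
    ChainComplex (ModuleCat.{u} R) ℕ :=
  ChainComplex.of
    (fun q => match q with
      | 0 => ModuleCat.of R Y
      | q + 1 => ModuleCat.of R (M ⊗[R] (barTerm X q).carrier))
    (fun q => match q with
      | 0 => ModuleCat.ofHom φ
      | q + 1 => ModuleCat.ofHom (twoSidedD M (barTerm X q) (barResolutionD X q)))
    (fun q => match q with
      | 0 => ModuleCat.hom_ext (LinearMap.ext fun t => aug_comp X φ hφ t)
      | q + 1 => ModuleCat.hom_ext (LinearMap.ext fun t =>
          twoSidedD_comp (barTerm X q) (barResolutionD X q) (barResolutionD_comp X q) t))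

end Bar

/-! ### Planar loops -/

section Loops
variable {R : Type u} [CommRing R]

/-- The chain complex `L(2n) = L(2n; R, a)` of planar loops, for `n ≥ 1`: the cone of
`Bar(TL(0, 2n), TL_{2n}, TL(2n, 0)) → TL(0, 2n) ⊗_{TL_{2n}} TL(2n, 0) → TL(0, 0)`, the last map being
composition. In degree `q > 0` it is `TL(0, 2n) ⊗ TL_{2n}^{⊗ (q - 1)} ⊗ TL(2n, 0)`, with differential
`(D₀ | … | D_q) ↦ ∑_{0 ≤ i < q} (-1)ⁱ (D₀ | … | Dᵢ Dᵢ₊₁ | … | D_q)`, in degree `0` it is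
`TL(0, 0) = R`. -/
noncomputable def planarLoops (a : R) (n : ℕ) : ChainComplex (ModuleCat.{u} R) ℕ :=
  barCone (A := TLAlg R a (2 * n)) (M := TLHom R a 0 (2 * n))
    { carrier := TLHom R a (2 * n) 0 } (TLHom R a 0 0)
    (TensorProduct.lift (TLHom.comp a)) (fun m b x => TLHom.comp_assoc m b x)

end Loops
end

end TemperleyLieb

-- The proof is dimension shifting. Fix `m = 2n`, `A = TL_m`, `X = TL(m, 0)`. For a right `A`-module
-- `M` with a balanced map `M ⊗ X → Y`, the cone `barCone` has `Y` in degree 0 and the bar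
-- construction `M ⊗ A^{⊗ q} ⊗ X` in degree `q + 1`. As `A` and `X` are free over `R`, a short exact
-- sequence of pairs `(M, Y)` gives one of cones. The pair `(TL(0, m), TL(0, 0))` gives `L(2n)`; a
-- pair with `Y = 0` gives `Tor_q(M, X)` in degree `q + 1` (`BarCoeff.torIso`).
--
-- These extremes are linked by `Q(k, j)`: the quotient of `TL(k, m)` by the diagrams with an arc
-- joining two neighbours among the lowest `j` left nodes, paired with the same quotient of `TL(k,
-- 0)`. Inserting a cup at `(j, j + 1)` yields the exact sequence `0 → Q(k, j) → Q(k + 2, j + 1) →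
-- Q(k + 2, j + 2) → 0` (`isShortExact_cup`).
--
-- For `j ≤ 1` nothing is killed, and for `1 ≤ k ≤ m` with `m - k` even a zigzag makes `TL(k, m)` a
-- retract of `A`, so the cone is contractible (`cupCoeff_acyclic_of_le_one`). Induction along the
-- exact sequences makes the cone acyclic whenever `j < k` (`cupCoeff_acyclic`). For `j = k` the
-- middle term is acyclic, so the connecting map identifies `H_{q+1}` of `Q(k + 2, k + 2)` with
-- `H_q` of `Q(k, k)` (`cupCoeff_homology`).
--
-- Going from `k = 0` to `k = 2n` takes `n` shifts. At the start, `Q(0, 0) = TL(0, m)` gives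
-- `L(2n)`. At the end, only the identity diagram survives in `Q(m, m)`, which is therefore the
-- trivial module, and its `Y` vanishes because every diagram in `TL(m, 0)` has a left cup. So
-- `Tor_q` is `H_{q+1}` of the last cone: zero for `q + 1 < n`, and `H_{q+1-n}(L(2n))` otherwise.

universe u
namespace TemperleyLieb
open CategoryTheory TensorProduct MulOpposite

/-! ### The cone complex as a functor of its coefficients -/

section BarCoeff
variable {R : Type u} [CommRing R] {A : Type u} [Ring A] [Algebra R A]

/-- Coefficients for `barCone`: a right `A`-module `M` with a balanced map `M ⊗ X → Y`. -/
structure BarCoeff (X : AlgMod R A) where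
  M : Type u
  [addCommGroupM : AddCommGroup M]
  [moduleM : Module R M]
  [rightModule : Module Aᵐᵒᵖ M]
  [isScalarTower : IsScalarTower R Aᵐᵒᵖ M]
  Y : Type u
  [addCommGroupY : AddCommGroup Y]
  [moduleY : Module R Y]
  φ : M ⊗[R] X.carrier →ₗ[R] Y
  balanced : ∀ (m : M) (b : A) (x : X.carrier), φ ((op b • m) ⊗ₜ x) = φ (m ⊗ₜ (b • x))

namespace BarCoeff
attribute [instance] addCommGroupM moduleM rightModule isScalarTower addCommGroupY moduleY

variable {X : AlgMod R A} (c c' c₁ c₂ c₃ : BarCoeff X)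

/-- The complex `barCone` with the given coefficients. -/
noncomputable abbrev complex : ChainComplex (ModuleCat.{u} R) ℕ :=
  barCone X c.Y c.φ c.balanced

/-- Morphisms of coefficients. -/
structure Hom where
  f : c.M →ₗ[R] c'.M
  f_op_smul : ∀ (b : A) (m : c.M), f (op b • m) = op b • f m
  g : c.Y →ₗ[R] c'.Y
  comm : ∀ (m : c.M) (x : X.carrier), g (c.φ (m ⊗ₜ x)) = c'.φ (f m ⊗ₜ x)

variable {c c' c₁ c₂ c₃}

variable (c) in
/-- The objects of `complex`. -/
noncomputable abbrev barX : ℕ → ModuleCat.{u} R := c.complex.X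

variable (c) in
/-- The differentials of `complex`. -/
noncomputable abbrev barD (q : ℕ) : barX c (q + 1) ⟶ barX c q :=
  match q with
  | 0 => ModuleCat.ofHom c.φ
  | q + 1 => ModuleCat.ofHom (twoSidedD c.M (barTerm X q) (barResolutionD X q))

theorem complex_d_one : c.complex.d 1 0 = ModuleCat.ofHom c.φ :=
  (ChainComplex.of_d (barX c) (barD c) 0)

theorem complex_d_succ (q : ℕ) : c.complex.d (q + 2) (q + 1) =
    ModuleCat.ofHom (twoSidedD c.M (barTerm X q) (barResolutionD X q)) :=
  (ChainComplex.of_d (barX c) (barD c) (q + 1))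

/-- The component in degree `q` of the map induced by a morphism of coefficients. -/
noncomputable def Hom.component (F : Hom c c') : (q : ℕ) → c.complex.X q ⟶ c'.complex.X q
  | 0 => ModuleCat.ofHom F.g
  | q + 1 => ModuleCat.ofHom (F.f.rTensor (barTerm X q).carrier)

/-- Only the term `m b ⊗ t` involves the action on `M`, and right linearity of `F.f` settles it; the
other term changes a different tensor factor. -/
theorem twoSidedD_rTensor (F : Hom c c') (T : AlgMod R A) (d : T.free.carrier →ₗ[A] T.carrier) :
    twoSidedD c'.M T d ∘ₗ F.f.rTensor T.free.carrier =
      F.f.rTensor T.carrier ∘ₗ twoSidedD c.M T d := by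
  ext m b t
  change twoSidedD c'.M T d (F.f m ⊗ₜ (b ⊗ₜ t)) =
    F.f.rTensor T.carrier (twoSidedD c.M T d (m ⊗ₜ (b ⊗ₜ t)))
  rw [twoSidedD_tmul, twoSidedD_tmul, map_sub, LinearMap.rTensor_tmul, LinearMap.rTensor_tmul,
    F.f_op_smul]

/-- The chain map induced by a morphism of coefficients. -/
noncomputable def Hom.map (F : Hom c c') : c.complex ⟶ c'.complex :=
  ChainComplex.ofHom F.component (by
    rintro (_ | q)
    · change _ ≫ c'.complex.d 1 0 = c.complex.d 1 0 ≫ _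
      rw [complex_d_one, complex_d_one]
      refine ModuleCat.hom_ext (TensorProduct.ext' fun m x => ?_)
      exact (F.comm m x).symm
    · change _ ≫ c'.complex.d (q + 2) (q + 1) = c.complex.d (q + 2) (q + 1) ≫ _
      rw [complex_d_succ, complex_d_succ]
      exact ModuleCat.hom_ext (twoSidedD_rTensor F _ _))

theorem barTerm_flat (hA : Module.Flat R A) (hX : Module.Flat R X.carrier) :
    ∀ q, Module.Flat R (barTerm X q).carrier
  | 0 => hX
  | q + 1 => by
    have := barTerm_flat hA hX q
    exact inferInstanceAs (Module.Flat R (A ⊗[R] (barTerm X q).carrier))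

/-- The isomorphism of complexes induced by a bijective morphism of coefficients. -/
theorem Hom.isIso_map (F : Hom c c') (hf : Function.Bijective F.f) (hg : Function.Bijective F.g) :
    IsIso F.map := by
  have : ∀ q, IsIso (F.map.f q) := by
    rintro (_ | q)
    · exact (LinearEquiv.ofBijective F.g hg).toModuleIso.isIso_hom
    · exact ((LinearEquiv.ofBijective F.f hf).rTensor (barTerm X q).carrier).toModuleIso.isIso_hom
  exact HomologicalComplex.Hom.isIso_of_components _

/-! ### Short exact sequences of coefficients and their connecting maps -/

/-- Two morphisms of coefficients forming short exact sequences on both components. -/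
structure IsShortExact (F : Hom c₁ c₂) (G : Hom c₂ c₃) : Prop where
  injective_f : Function.Injective F.f
  exact_f : Function.Exact F.f G.f
  surjective_f : Function.Surjective G.f
  injective_g : Function.Injective F.g
  exact_g : Function.Exact F.g G.g
  surjective_g : Function.Surjective G.g

/-- Flatness of the bar terms is needed for injectivity only; the rest is right exactness of the
tensor product. -/
theorem IsShortExact.component {F : Hom c₁ c₂} {G : Hom c₂ c₃} (h : IsShortExact F G)
    (hA : Module.Flat R A) (hX : Module.Flat R X.carrier) (q : ℕ) :
    Function.Injective (F.map.f q).hom ∧ Function.Exact (F.map.f q).hom (G.map.f q).hom ∧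
      Function.Surjective (G.map.f q).hom := by
  rcases q with _ | q
  · exact ⟨h.injective_g, h.exact_g, h.surjective_g⟩
  · have := barTerm_flat hA hX q
    exact ⟨Module.Flat.rTensor_preserves_injective_linearMap F.f h.injective_f,
      rTensor_exact _ h.exact_f h.surjective_f, LinearMap.rTensor_surjective _ h.surjective_f⟩

theorem IsShortExact.comp_eq_zero {F : Hom c₁ c₂} {G : Hom c₂ c₃} (h : IsShortExact F G)
    (hA : Module.Flat R A) (hX : Module.Flat R X.carrier) : F.map ≫ G.map = 0 := by
  ext q x
  exact (h.component hA hX q).2.1.apply_apply_eq_zero x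

theorem IsShortExact.shortExact {F : Hom c₁ c₂} {G : Hom c₂ c₃} (h : IsShortExact F G)
    (hA : Module.Flat R A) (hX : Module.Flat R X.carrier) :
    (ShortComplex.mk F.map G.map (h.comp_eq_zero hA hX)).ShortExact :=
  HomologicalComplex.shortExact_of_degreewise_shortExact _ fun q =>
    ModuleCat.shortComplex_shortExact _ (h.component hA hX q).2.1 (h.component hA hX q).1
      (h.component hA hX q).2.2

/-- The connecting homomorphism lies between two vanishing groups of the middle complex. This is the
dimension shift on which the whole proof rests. -/
theorem IsShortExact.homologyIso {F : Hom c₁ c₂} {G : Hom c₂ c₃} (h : IsShortExact F G)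
    (hA : Module.Flat R A) (hX : Module.Flat R X.carrier) (h₂ : c₂.complex.Acyclic) (q : ℕ) :
    Nonempty (c₃.complex.homology (q + 1) ≅ c₁.complex.homology q) :=
  ⟨(h.shortExact hA hX).δIso (q + 1) q rfl (h₂ _).isZero_homology (h₂ _).isZero_homology⟩

theorem exactAt_zero (h : Function.Surjective c.φ) : c.complex.ExactAt 0 := by
  -- Degree 0 has no successor in a chain complex; by convention its successor is 0 itself, and `d 0
  -- 0 = 0`. Exactness there is thus surjectivity of `φ`.
  rw [HomologicalComplex.exactAt_iff' _ 1 0 0 (by simp) (by simp)]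
  refine ModuleCat.shortComplex_exact _ fun y => ⟨fun _ => ?_, fun _ => ?_⟩
  · change y ∈ Set.range (c.complex.d 1 0).hom
    rw [complex_d_one]
    exact h y
  · change (c.complex.d 0 0).hom y = 0
    rw [c.complex.shape 0 0 (by simp)]; rfl

theorem surjective_of_exactAt_zero (h : c.complex.ExactAt 0) : Function.Surjective c.φ := by
  rw [HomologicalComplex.exactAt_iff' _ 1 0 0 (by simp) (by simp),
    ShortComplex.moduleCat_exact_iff] at h
  intro y
  obtain ⟨x, hx⟩ := h y (by
    change (c.complex.d 0 0).hom y = 0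
    rw [c.complex.shape 0 0 (by simp)]; rfl)
  refine ⟨x, ?_⟩
  change (c.complex.d 1 0).hom x = y at hx
  rwa [complex_d_one] at hx

/-- The connecting isomorphism reaches only degrees `q + 1` of the quotient complex. In degree 0 the
reason is that surjectivity of `φ` passes to quotients, which needs no flatness. -/
theorem IsShortExact.exactAt_zero {F : Hom c₁ c₂} {G : Hom c₂ c₃} (h : IsShortExact F G)
    (h₂ : c₂.complex.ExactAt 0) : c₃.complex.ExactAt 0 := by
  refine BarCoeff.exactAt_zero fun y => ?_
  obtain ⟨y, rfl⟩ := h.surjective_g y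
  obtain ⟨x, rfl⟩ := surjective_of_exactAt_zero h₂ y
  refine ⟨G.f.rTensor X.carrier x, ?_⟩
  have : c₃.φ ∘ₗ G.f.rTensor X.carrier = G.g ∘ₗ c₂.φ :=
    TensorProduct.ext' fun m x => (G.comm m x).symm
  exact LinearMap.congr_fun this x

theorem IsShortExact.acyclic {F : Hom c₁ c₂} {G : Hom c₂ c₃} (h : IsShortExact F G)
    (hA : Module.Flat R A) (hX : Module.Flat R X.carrier) (h₁ : c₁.complex.Acyclic)
    (h₂ : c₂.complex.Acyclic) : c₃.complex.Acyclic := by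
  rintro (_ | q)
  · exact h.exactAt_zero (h₂ 0)
  · obtain ⟨e⟩ := h.homologyIso hA hX h₂ q
    rw [HomologicalComplex.exactAt_iff_isZero_homology]
    exact (h₁ q).isZero_homology.of_iso e

/-! ### Contractibility for retracts of the algebra -/

/-- A coefficient system in which `m = α · β(m)` naturally has acyclic complex. -/
theorem acyclic_of_retract (α : c.M) (β : c.M →ₗ[R] A) (β' : c.Y →ₗ[R] X.carrier)
    (hβ : ∀ m (b : A), β (op b • m) = β m * b) (hα : ∀ m, op (β m) • α = m)
    (hβ' : ∀ m x, β' (c.φ (m ⊗ₜ x)) = β m • x) (hα' : ∀ y, c.φ (α ⊗ₜ β' y) = y) :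
    c.complex.Acyclic := by
  -- The contracting homotopy is `m ⊗ t ↦ α ⊗ β m ⊗ t`: multiplying the first two factors gives back
  -- `α · β m = m`. In degree 0 it is `y ↦ α ⊗ β' y`.
  let s (T : AlgMod R A) : c.M ⊗[R] T.carrier →ₗ[R] c.M ⊗[R] T.free.carrier :=
    TensorProduct.mk R c.M T.free.carrier α ∘ₗ β.rTensor T.carrier
  have hs : ∀ (T : AlgMod R A) m (t : T.carrier), s T (m ⊗ₜ t) = α ⊗ₜ (β m ⊗ₜ t) :=
    fun _ _ _ => rfl
  rintro (_ | _ | q)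
  · exact exactAt_zero fun y => ⟨_, hα' y⟩
  · have key : ∀ t : c.M ⊗[R] X.carrier,
        twoSidedD c.M X (actMap X) (s X t) + α ⊗ₜ β' (c.φ t) = t := by
      intro t
      induction t using TensorProduct.induction_on with
      | zero => simp
      | add x y hx hy =>
        -- The third occurrences are those on the right-hand side; the earlier ones are arguments of
        -- the homotopy and must stay.
        nth_rw 3 [← hx, ← hy]
        simp only [map_add, TensorProduct.tmul_add]
        abel
      | tmul m t =>
        rw [hs, twoSidedD_tmul, hα, actMap_tmul, hβ', sub_add_cancel]
    rw [HomologicalComplex.exactAt_iff' _ 2 1 0 (by simp) (by simp)]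
    refine (ShortComplex.moduleCat_exact_iff _).2 fun t ht => ⟨s X t, ?_⟩
    change (c.complex.d 1 0).hom t = 0 at ht
    change (c.complex.d 2 1).hom (s X t) = t
    rw [complex_d_one] at ht
    rw [complex_d_succ]
    have := key t
    rw [show c.φ t = 0 from ht, map_zero, TensorProduct.tmul_zero, add_zero] at this
    exact this
  -- The homotopy identity in degrees at least 2; the differential `d` of the bar terms is
  -- arbitrary, so no induction on the degree is needed.
  · have key : ∀ (T : AlgMod R A) (d : T.free.carrier →ₗ[A] T.carrier)
        (t : c.M ⊗[R] T.free.carrier),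
        twoSidedD c.M T.free (nextD T d) (s T.free t) + s T (twoSidedD c.M T d t) = t := by
      intro T d t
      induction t using TensorProduct.induction_on with
      | zero => simp
      | add x y hx hy =>
        nth_rw 3 [← hx, ← hy]
        simp only [map_add]
        abel
      | tmul m t =>
        induction t using TensorProduct.induction_on with
        | zero => simp
        | add x y hx hy =>
          rw [TensorProduct.tmul_add]
          nth_rw 3 [← hx, ← hy]
          simp only [map_add]
          abel
        | tmul b t =>
          rw [hs, twoSidedD_tmul, hα, nextD_tmul, twoSidedD_tmul, map_sub, hs, hs, hβ,
            TensorProduct.tmul_sub, TensorProduct.smul_tmul', smul_eq_mul]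
          abel
    rw [HomologicalComplex.exactAt_iff' _ (q + 3) (q + 2) (q + 1) (by simp) (by simp)]
    refine (ShortComplex.moduleCat_exact_iff _).2 fun t ht => ⟨s _ t, ?_⟩
    change (c.complex.d (q + 2) (q + 1)).hom t = 0 at ht
    change (c.complex.d (q + 3) (q + 2)).hom (s _ t) = t
    rw [complex_d_succ] at ht ⊢
    have := key (barTerm X q) (barResolutionD X q) t
    rw [show twoSidedD c.M (barTerm X q) (barResolutionD X q) t = 0 from ht, map_zero,
      add_zero] at this
    exact this

end BarCoeff
end BarCoeff
end TemperleyLieb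

/-! ### Tor through the bar resolution -/

namespace TemperleyLieb
open CategoryTheory TensorProduct MulOpposite

theorem BalancedTensor.mk_op_smul {R A M N : Type u} [CommRing R] [Ring A] [AddCommGroup M]
    [Module R M] [Module Aᵐᵒᵖ M] [AddCommGroup N] [Module A N] (m : M) (b : A) (x : N) :
    (Submodule.Quotient.mk ((op b • m) ⊗ₜ[ℤ] x) : BalancedTensor R A M N) =
      Submodule.Quotient.mk (m ⊗ₜ[ℤ] (b • x)) :=
  (Submodule.Quotient.eq _).2 (Submodule.subset_span ⟨m, b, x, rfl⟩)

section BarTor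
variable {R : Type u} [CommRing R] {A : Type u} [Ring A] [Algebra R A]

section
variable (M : Type u) [AddCommGroup M] [Module R M] [Module Aᵐᵒᵖ M] [IsScalarTower R Aᵐᵒᵖ M]
  (T : AlgMod R A)

/-- The map `M ⊗_A (A ⊗ T) → M ⊗ T`, `m ⊗ b ⊗ t ↦ m b ⊗ t`. -/
noncomputable def balancedFreeTo :
    BalancedTensor R A M T.free.carrier →ₗ[R] M ⊗[R] T.carrier :=
  Submodule.liftQ _
    (TensorProduct.AlgebraTensorModule.lift
      -- The balanced tensor product is a quotient of a tensor product over `ℤ`, so the `R`-bilinear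
      -- map is regarded as only additive in its second variable.
      (LinearMap.restrictScalarsₗ ℤ R T.free.carrier (M ⊗[R] T.carrier) R ∘ₗ
        TensorProduct.curry ((rightActMap R A M).rTensor T.carrier ∘ₗ
          (TensorProduct.assoc R M A T.carrier).symm.toLinearMap)))
    (by
      rw [balancedRel, Submodule.span_le]
      rintro _ ⟨m, b, t, rfl⟩
      rw [SetLike.mem_coe, LinearMap.mem_ker, map_sub, sub_eq_zero]
      induction t using TensorProduct.induction_on with
      | zero => simp
      | add x y hx hy => simp only [smul_add, TensorProduct.tmul_add, map_add, hx, hy]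
      | tmul b' t =>
        change (op b' • op b • m) ⊗ₜ[R] t = (op (b * b') • m) ⊗ₜ[R] t
        rw [op_mul, mul_smul])

theorem balancedFreeTo_mk (m : M) (b : A) (t : T.carrier) :
    balancedFreeTo M T (Submodule.Quotient.mk (m ⊗ₜ[ℤ] (b ⊗ₜ[R] t))) = (op b • m) ⊗ₜ[R] t := rfl

/-- The map `M ⊗ T → M ⊗_A (A ⊗ T)`, `m ⊗ t ↦ m ⊗ 1 ⊗ t`. -/
noncomputable def balancedFreeFrom :
    M ⊗[R] T.carrier →ₗ[R] BalancedTensor R A M T.free.carrier :=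
  TensorProduct.lift (LinearMap.mk₂ R
    (fun m t => Submodule.Quotient.mk (m ⊗ₜ[ℤ] ((1 : A) ⊗ₜ[R] t)))
    (fun m m' t => by rw [TensorProduct.add_tmul]; rfl)
    (fun r m t => by rw [← TensorProduct.smul_tmul']; rfl)
    (fun m t t' => by rw [TensorProduct.tmul_add, TensorProduct.tmul_add]; rfl)
    (fun r m t => by
      -- A scalar of `R` crosses the tensor sign as the element `algebraMap R A r`, by the relation
      -- defining the balanced tensor product.
      rw [TensorProduct.tmul_smul, ← algebraMap_smul A r ((1 : A) ⊗ₜ[R] t),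
        ← BalancedTensor.mk_op_smul]
      rw [show op (algebraMap R A r) = algebraMap R Aᵐᵒᵖ r from rfl, algebraMap_smul,
        ← TensorProduct.smul_tmul']
      rfl))

theorem balancedFreeFrom_tmul (m : M) (t : T.carrier) :
    balancedFreeFrom M T (m ⊗ₜ t) = Submodule.Quotient.mk (m ⊗ₜ[ℤ] ((1 : A) ⊗ₜ[R] t)) := rfl

/-- The isomorphism `M ⊗_A (A ⊗ T) ≅ M ⊗ T`. -/
noncomputable def balancedFreeEquiv :
    BalancedTensor R A M T.free.carrier ≃ₗ[R] M ⊗[R] T.carrier :=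
  LinearEquiv.ofLinearMap (balancedFreeTo M T) (balancedFreeFrom M T)
    (TensorProduct.ext' fun m t => by
      rw [LinearMap.comp_apply, balancedFreeFrom_tmul, balancedFreeTo_mk, op_one, one_smul]; rfl)
    (BalancedTensor.hom_ext R A M fun m t => by
      induction t using TensorProduct.induction_on with
      | zero => simp
      | add x y hx hy =>
        rw [TensorProduct.tmul_add, Submodule.Quotient.mk_add, map_add, map_add, hx, hy]
      | tmul b t =>
        rw [LinearMap.comp_apply, balancedFreeTo_mk, balancedFreeFrom_tmul,
          BalancedTensor.mk_op_smul, TensorProduct.smul_tmul', smul_eq_mul, mul_one]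
        rfl)

/-- In `M ⊗_A -` the leading factor `b` of `b • t` moves onto `m`, which turns the first term of the
bar differential into the term `m b ⊗ t` of the two-sided one. -/
theorem balancedFreeTo_map_nextD (d : T.free.carrier →ₗ[A] T.carrier) :
    balancedFreeTo M T ∘ₗ BalancedTensor.map R A M (nextD T d) =
      twoSidedD M T d ∘ₗ balancedFreeTo M T.free := by
  refine BalancedTensor.hom_ext R A M fun m t => ?_
  change balancedFreeTo M T (Submodule.Quotient.mk (m ⊗ₜ[ℤ] (nextD T d t))) =
    twoSidedD M T d (balancedFreeTo M T.free (Submodule.Quotient.mk (m ⊗ₜ[ℤ] t)))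
  induction t using TensorProduct.induction_on with
  | zero => simp
  | add x y hx hy =>
    simp only [map_add, TensorProduct.tmul_add, Submodule.Quotient.mk_add, hx, hy]
  | tmul b t =>
    rw [nextD_tmul, TensorProduct.tmul_sub, Submodule.Quotient.mk_sub, map_sub,
      show balancedFreeTo M T (Submodule.Quotient.mk (m ⊗ₜ[ℤ] (b • t))) =
        balancedFreeTo M T (Submodule.Quotient.mk ((op b • m) ⊗ₜ[ℤ] t)) from
        congrArg _ (BalancedTensor.mk_op_smul m b t).symm, balancedFreeTo_mk, balancedFreeTo_mk]
    induction t using TensorProduct.induction_on with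
    | zero => simp
    | add x y hx hy =>
      simp only [map_add, TensorProduct.tmul_add, Submodule.Quotient.mk_add, ← hx, ← hy]
      abel
    | tmul b' t => rw [balancedFreeTo_mk, twoSidedD_tmul]

end

variable (X : AlgMod R A)

/-- The bar resolution `A ⊗ A^{⊗ q} ⊗ X` of `X`. -/
noncomputable def barResolution : ChainComplex (ModuleCat.{u} A) ℕ :=
  ChainComplex.of (fun q => ModuleCat.of A (barTerm X q).free.carrier)
    (fun q => ModuleCat.ofHom (barResolutionD X (q + 1)))
    (fun q => ModuleCat.hom_ext (LinearMap.ext fun t => barResolutionD_comp X (q + 1) t))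

theorem barResolution_d (q : ℕ) : (barResolution X).d (q + 1) q =
    ModuleCat.ofHom (barResolutionD X (q + 1)) :=
  ChainComplex.of_d (fun q => ModuleCat.of A (barTerm X q).free.carrier)
    (fun q => ModuleCat.ofHom (barResolutionD X (q + 1))) q

/-- The operation `t ↦ 1 ⊗ t` contracts the augmented bar complex. It is only `R`-linear, but
exactness needs no more. -/
theorem nextD_one_tmul (T : AlgMod R A) (d : T.free.carrier →ₗ[A] T.carrier)
    (t : T.free.carrier) (h : d t = 0) : nextD T d ((1 : A) ⊗ₜ[R] t) = t := by
  rw [nextD_tmul, one_smul, h, TensorProduct.tmul_zero, sub_zero]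

theorem barResolutionD_exact (q : ℕ) :
    Function.Exact (barResolutionD X (q + 1)) (barResolutionD X q) := fun t =>
  ⟨fun h => ⟨_, nextD_one_tmul _ _ t h⟩, by rintro ⟨t, rfl⟩; exact barResolutionD_comp X q t⟩

/-- Projectivity over `R` of the bar terms `T` makes the modules `A ⊗ T` of the resolution
projective over `A`. -/
theorem barTerm_projective (hA : Module.Projective R A) (hX : Module.Projective R X.carrier) :
    ∀ q, Module.Projective R (barTerm X q).carrier
  | 0 => hX
  | q + 1 => by
    have := barTerm_projective hA hX q
    exact inferInstanceAs (Module.Projective R (A ⊗[R] (barTerm X q).carrier))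

theorem actMap_surjective : Function.Surjective (actMap X) := fun x =>
  ⟨(1 : A) ⊗ₜ[R] x, by rw [actMap_tmul, one_smul]⟩

/-- The augmentation of the bar resolution in degree `0`. -/
noncomputable def barAugmentationZero : (barResolution X).X 0 ⟶ ModuleCat.of A X.carrier :=
  ModuleCat.ofHom (actMap X)

theorem barResolution_d_augmentation :
    (barResolution X).d 1 0 ≫ barAugmentationZero X = 0 := by
  rw [barResolution_d]
  exact ModuleCat.hom_ext (LinearMap.ext fun t => barResolutionD_comp X 0 t)

/-- The augmentation of the bar resolution. -/
noncomputable def barAugmentation :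
    barResolution X ⟶ (ChainComplex.single₀ _).obj (ModuleCat.of A X.carrier) :=
  (ChainComplex.toSingle₀Equiv _ _).symm ⟨_, barResolution_d_augmentation X⟩

theorem barAugmentation_f_zero : (barAugmentation X).f 0 = barAugmentationZero X :=
  ChainComplex.toSingle₀Equiv_symm_apply_f_zero _ _

/-- The bar resolution as a projective resolution. -/
noncomputable def barProjectiveResolution (hA : Module.Projective R A)
    (hX : Module.Projective R X.carrier) : ProjectiveResolution (ModuleCat.of A X.carrier) where
  complex := barResolution X
  projective q := by
    have := barTerm_projective X hA hX q
    have : Module.Projective A (A ⊗[R] (barTerm X q).carrier) := inferInstance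
    exact ModuleCat.projective_of_categoryTheory_projective
      (P := ModuleCat.of A (A ⊗[R] (barTerm X q).carrier))
  π := barAugmentation X
  quasiIso := ⟨fun q => by
    cases q with
    | zero =>
      -- In degree 0 a quasi-isomorphism means that the action map is a cokernel of `d 1 0`:
      -- exactness and surjectivity.
      rw [ChainComplex.quasiIsoAt₀_iff, ShortComplex.quasiIso_iff_of_zeros' _ rfl rfl rfl]
      constructor
      · refine ModuleCat.shortComplex_exact _ fun t => ?_
        change ModuleCat.Hom.hom ((barAugmentation X).f 0) t = 0 ↔
          t ∈ Set.range ((barResolution X).d 1 0).hom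
        rw [barAugmentation_f_zero, barResolution_d]
        exact barResolutionD_exact X 0 t
      · change Epi ((barAugmentation X).f 0)
        rw [barAugmentation_f_zero]
        exact (ModuleCat.epi_iff_surjective (barAugmentationZero X)).2 (actMap_surjective X)
    | succ q =>
      rw [quasiIsoAt_iff_exactAt' _ _ (ChainComplex.exactAt_succ_single_obj _ _),
        HomologicalComplex.exactAt_iff' _ (q + 2) (q + 1) q (by simp) (by simp)]
      refine ModuleCat.shortComplex_exact _ fun t => ?_
      change ((barResolution X).d (q + 1) q).hom t = 0 ↔
        t ∈ Set.range ((barResolution X).d (q + 2) (q + 1)).hom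
      rw [barResolution_d, barResolution_d]
      exact barResolutionD_exact X (q + 1) t⟩

variable {X}

/-- The complex `M ⊗_A Bar(A, A, X)`. -/
noncomputable abbrev BarCoeff.tensorBar (c : BarCoeff X) : ChainComplex (ModuleCat.{u} R) ℕ :=
  ((tensorFunctor R A c.M).mapHomologicalComplex _).obj (barResolution X)

/-- The isomorphism between `M ⊗_A Bar(A, A, X)` in degree `q` and `barCone` in degree `q + 1`. -/
noncomputable def BarCoeff.tensorBarIso (c : BarCoeff X) (q : ℕ) :
    c.tensorBar.X q ≅ c.complex.X (q + 1) :=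
  (balancedFreeEquiv c.M (barTerm X q)).toModuleIso

theorem BarCoeff.tensorBarIso_comm (c : BarCoeff X) (q : ℕ) :
    (c.tensorBarIso (q + 1)).hom ≫ c.complex.d (q + 2) (q + 1) =
      c.tensorBar.d (q + 1) q ≫ (c.tensorBarIso q).hom := by
  rw [complex_d_succ]
  change _ = (tensorFunctor R A c.M).map ((barResolution X).d (q + 1) q) ≫ _
  rw [barResolution_d]
  exact (ModuleCat.hom_ext (balancedFreeTo_map_nextD c.M (barTerm X q) (barResolutionD X q))).symm

/-- If `Y = 0`, then `barCone` computes `Tor` up to a shift. -/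
theorem BarCoeff.torIso (c : BarCoeff X) (hA : Module.Projective R A)
    (hX : Module.Projective R X.carrier) [Subsingleton c.Y] (q : ℕ) :
    Nonempty (TorModule R A c.M q X.carrier ≅ c.complex.homology (q + 1)) := by
  have e : TorModule R A c.M q X.carrier ≅ c.tensorBar.homology q :=
    (barProjectiveResolution X hA hX).isoLeftDerivedObj (tensorFunctor R A c.M) q
  suffices h : Nonempty (c.complex.homology (q + 1) ≅ c.tensorBar.homology q) from
    ⟨e ≪≫ h.some.symm⟩
  rcases q with _ | q
  · have hz : Limits.IsZero (c.complex.X 0) := ModuleCat.isZero_of_subsingleton (ModuleCat.of R c.Y)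
    -- The two short complexes differ in their last term: the cone ends in `Y = 0`, whereas degree 0
    -- of the bar complex is, by convention, followed by itself with zero differential. A zero map
    -- between these terms is mono because its source vanishes, and that suffices for a
    -- quasi-isomorphism.
    let f : c.complex.sc' 2 1 0 ⟶ c.tensorBar.sc' 1 0 0 :=
      { τ₁ := (c.tensorBarIso 1).inv
        τ₂ := (c.tensorBarIso 0).inv
        τ₃ := 0
        comm₁₂ := by
          change (c.tensorBarIso 1).inv ≫ c.tensorBar.d 1 0 =
            c.complex.d 2 1 ≫ (c.tensorBarIso 0).inv
          rw [Iso.inv_comp_eq, ← Category.assoc, Iso.eq_comp_inv]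
          exact (c.tensorBarIso_comm 0).symm
        comm₂₃ := by
          change _ ≫ c.tensorBar.d 0 0 = _
          rw [c.tensorBar.shape 0 0 (by simp)]
          exact Limits.comp_zero.trans Limits.comp_zero.symm }
    have : Mono f.τ₃ := ⟨fun _ _ _ => hz.eq_of_tgt _ _⟩
    have : Epi f.τ₁ := inferInstanceAs (Epi (c.tensorBarIso 1).inv)
    have : IsIso f.τ₂ := inferInstanceAs (IsIso (c.tensorBarIso 0).inv)
    have : ShortComplex.QuasiIso f := ShortComplex.quasiIso_of_epi_of_isIso_of_mono f
    exact ⟨c.complex.homologyIsoSc' 2 1 0 (by simp) (by simp) ≪≫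
      asIso (ShortComplex.homologyMap f) ≪≫
      (c.tensorBar.homologyIsoSc' 1 0 0 (by simp) (by simp)).symm⟩
  · let f : c.tensorBar.sc' (q + 2) (q + 1) q ≅ c.complex.sc' (q + 3) (q + 2) (q + 1) :=
      ShortComplex.isoMk (c.tensorBarIso (q + 2)) (c.tensorBarIso (q + 1)) (c.tensorBarIso q)
        (c.tensorBarIso_comm (q + 1)) (c.tensorBarIso_comm q)
    exact ⟨c.complex.homologyIsoSc' (q + 3) (q + 2) (q + 1) (by simp) (by simp) ≪≫
      (ShortComplex.homologyMapIso f).symm ≪≫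
      (c.tensorBar.homologyIsoSc' (q + 2) (q + 1) q (by simp) (by simp)).symm⟩

end BarTor
end TemperleyLieb

/-! ### Diagrams with one cup or one cap -/

namespace TemperleyLieb
open Relation

/-- The order embedding of `k` nodes into `k + 2` nodes omitting the nodes `j` and `j + 1`. -/
def skipTwo {k : ℕ} (j : ℕ) (i : Fin k) : Fin (k + 2) :=
  if (i : ℕ) < j then ⟨i, by omega⟩ else ⟨i + 2, by omega⟩

theorem skipTwo_val {k : ℕ} (j : ℕ) (i : Fin k) :
    (skipTwo j i : ℕ) = if (i : ℕ) < j then (i : ℕ) else i + 2 := by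
  unfold skipTwo; split_ifs <;> rfl

/-- The map induced by `skipTwo` on the boundary nodes of diagrams. -/
abbrev skipNode {k m : ℕ} (j : ℕ) : Fin k ⊕ Fin m → Fin (k + 2) ⊕ Fin m :=
  Sum.map (skipTwo j) id

/-- Non-crossing depends only on the order along the boundary, so it can be carried in both
directions when two adjacent nodes are inserted or deleted. -/
theorem bdPos_skipNode {k m : ℕ} (j : ℕ) (u v : Fin k ⊕ Fin m) :
    bdPos (skipNode j u) < bdPos (skipNode j v) ↔ bdPos u < bdPos v := by
  rcases u with u | u <;> rcases v with v | v <;>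
    simp only [Sum.map_inl, Sum.map_inr, id, bdPos, skipTwo_val] <;> (try split_ifs) <;> omega

theorem skipNode_injective {k m : ℕ} (j : ℕ) :
    Function.Injective (skipNode j : Fin k ⊕ Fin m → Fin (k + 2) ⊕ Fin m) := by
  intro u v h
  apply bdPos_inj
  have h1 := bdPos_skipNode j u v
  have h2 := bdPos_skipNode j v u
  rw [h] at h1 h2
  omega

theorem exists_skipNode {k m : ℕ} {j : ℕ} (hj : j ≤ k) (x : Fin (k + 2) ⊕ Fin m)
    (h1 : x ≠ Sum.inl ⟨j, by omega⟩) (h2 : x ≠ Sum.inl ⟨j + 1, by omega⟩) :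
    ∃ u, skipNode j u = x := by
  rcases x with x | x
  · rw [Ne, Sum.inl.injEq, Fin.ext_iff] at h1 h2
    simp only at h1 h2
    by_cases hx : (x : ℕ) < j
    · refine ⟨Sum.inl ⟨x, by omega⟩, congrArg Sum.inl (Fin.ext ?_)⟩
      rw [skipTwo_val, if_pos hx]
    · refine ⟨Sum.inl ⟨x - 2, by omega⟩, congrArg Sum.inl (Fin.ext ?_)⟩
      rw [skipTwo_val, if_neg (by simp only; omega)]
      simp only
      omega
  · exact ⟨Sum.inr x, rfl⟩

theorem skipTwo_ne {k : ℕ} (j : ℕ) (i : Fin k) :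
    (skipTwo j i : ℕ) ≠ j ∧ (skipTwo j i : ℕ) ≠ j + 1 := by
  rw [skipTwo_val]; split_ifs <;> omega

namespace Diagram
variable {k l m n : ℕ}

/-- The partner function of `cupDiagram`. -/
def cupPartner (k j : ℕ) (hj : j ≤ k) : Fin (k + 2) ⊕ Fin k → Fin (k + 2) ⊕ Fin k
  | Sum.inl x =>
    if h1 : (x : ℕ) < j then Sum.inr ⟨x, by omega⟩
    else if h2 : (x : ℕ) = j then Sum.inl ⟨j + 1, by omega⟩
    else if h3 : (x : ℕ) = j + 1 then Sum.inl ⟨j, by omega⟩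
    else Sum.inr ⟨x - 2, by omega⟩
  | Sum.inr y => Sum.inl (skipTwo j y)

theorem cupPartner_skipTwo (j : ℕ) (hj : j ≤ k) (y : Fin k) :
    cupPartner k j hj (Sum.inl (skipTwo j y)) = Sum.inr y := by
  have h := skipTwo_val j y
  unfold cupPartner
  simp only [h]
  by_cases hy : (y : ℕ) < j
  · simp [hy]
  · simp only [hy, if_false]
    rw [dif_neg (by omega), dif_neg (by omega), dif_neg (by omega)]
    congr 1

theorem cupPartner_left (j : ℕ) (hj : j ≤ k) :
    cupPartner k j hj (Sum.inl ⟨j, by omega⟩) = Sum.inl ⟨j + 1, by omega⟩ := by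
  simp [cupPartner]

theorem cupPartner_right (j : ℕ) (hj : j ≤ k) :
    cupPartner k j hj (Sum.inl ⟨j + 1, by omega⟩) = Sum.inl ⟨j, by omega⟩ := by
  simp [cupPartner]

/-- A case split adapted to `cupDiagram`: the two ends of the cup, and all remaining nodes. -/
theorem cup_cases (j : ℕ) (hj : j ≤ k) {P : Fin (k + 2) ⊕ Fin m → Prop}
    (h1 : P (Sum.inl ⟨j, by omega⟩)) (h2 : P (Sum.inl ⟨j + 1, by omega⟩))
    (h : ∀ u, P (skipNode j u)) (x) : P x := by
  by_cases hx1 : x = Sum.inl ⟨j, by omega⟩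
  · rwa [hx1]
  by_cases hx2 : x = Sum.inl ⟨j + 1, by omega⟩
  · rwa [hx2]
  obtain ⟨u, rfl⟩ := exists_skipNode hj x hx1 hx2
  exact h u

/-- The diagram with an arc joining the left nodes `j` and `j + 1` and `k` further arcs joining the
two bars. -/
def cupDiagram (k j : ℕ) (hj : j ≤ k) : Diagram (k + 2) k where
  partner := cupPartner k j hj
  partner_partner := by
    refine cup_cases j hj ?_ ?_ ?_
    · rw [cupPartner_left, cupPartner_right]
    · rw [cupPartner_right, cupPartner_left]
    · rintro (y | y)
      · rw [skipNode, Sum.map_inl, cupPartner_skipTwo]; rfl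
      · exact cupPartner_skipTwo j hj y
  partner_ne := by
    refine cup_cases j hj ?_ ?_ ?_
    · rw [cupPartner_left]; simp
    · rw [cupPartner_right]; simp
    · rintro (y | y)
      · rw [skipNode, Sum.map_inl, cupPartner_skipTwo]; simp
      · simp [cupPartner]
  noncrossing := by
    have hs : ∀ y : Fin k, cupPartner k j hj (skipNode j (Sum.inl y)) = Sum.inr y :=
      cupPartner_skipTwo j hj
    have hs' : ∀ y : Fin k, cupPartner k j hj (skipNode j (Sum.inr y)) =
      Sum.inl (skipTwo j y) := fun _ => rfl
    refine cup_cases j hj ?_ ?_ ?_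
    · intro y
      rw [cupPartner_left]
      simp only [bdPos]
      omega
    · intro y
      rw [cupPartner_right]
      simp only [bdPos]
      omega
    · intro x
      refine cup_cases j hj ?_ ?_ ?_
      · rw [cupPartner_left]
        rcases x with x | x
        · rw [hs]; simp only [bdPos]; omega
        · rw [hs']; simp only [bdPos, Sum.map_inr, id]; omega
      · rw [cupPartner_right]
        rcases x with x | x
        · rw [hs]; simp only [bdPos]; omega
        · rw [hs']; simp only [bdPos, Sum.map_inr, id]; omega
      · intro y
        rcases x with x | x <;> rcases y with y | y <;> simp only [hs, hs'] <;>
          simp only [bdPos, Sum.map_inl, Sum.map_inr, id, skipTwo_val] <;>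
          (try split_ifs) <;> omega

/-- The diagram with an arc joining the right nodes `0` and `1` and `k` further arcs joining the
two bars. -/
def capDiagram (k : ℕ) : Diagram k (k + 2) where
  partner
    | Sum.inl x => Sum.inr ⟨x + 2, by omega⟩
    | Sum.inr y => if h0 : (y : ℕ) = 0 then Sum.inr ⟨1, by omega⟩
      else if h1 : (y : ℕ) = 1 then Sum.inr ⟨0, by omega⟩ else Sum.inl ⟨y - 2, by omega⟩
  partner_partner := by
    rintro (x | x)
    · simp
    · by_cases h0 : (x : ℕ) = 0
      · simp [h0, Fin.ext_iff]
      · by_cases h1 : (x : ℕ) = 1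
        · simp [h1, Fin.ext_iff]
        · simp only [h0, h1, dite_false]
          congr 1
          ext; simp only; omega
  partner_ne := by
    rintro (x | x)
    · simp
    · simp only
      split_ifs <;> simp [Fin.ext_iff] <;> omega
  noncrossing := by
    rintro (x | x) (y | y) <;> simp only <;> (try split_ifs) <;> simp only [bdPos] <;> omega

/-- Gluing on the right does not touch an arc with both ends on the outer left bar. Hence left cups
persist, and the quotients by them are right modules. -/
theorem comp_partner_inl (D : Diagram l m) (E : Diagram m n) {x y : Fin l}
    (h : D.partner (Sum.inl x) = Sum.inl y) : (D.comp E).partner (Sum.inl x) = Sum.inl y := by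
  have h1 : EqvGen (glueAdj D.partner E.partner) (gOuter (Sum.inl x)) (gOuter (Sum.inl y)) :=
    .rel _ _ (Or.inl ⟨Sum.inl x, rfl, by rw [h]; rfl⟩)
  rcases (D.isGlue_comp E _ _).1 h1 with h2 | h2
  · exact absurd (h.trans (congrArg Sum.inl (Sum.inl_injective h2))) (D.partner_ne _)
  · exact h2.symm

theorem cupDiagram_path (j : ℕ) (hj : j ≤ k) (D : Diagram k m) (u : Fin k ⊕ Fin m) :
    EqvGen (glueAdj (cupDiagram k j hj).partner D.partner) (gOuter (skipNode j u)) (Sum.inr u) := by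
  rcases u with u | u
  · refine .rel _ _ (Or.inl ⟨Sum.inl (skipTwo j u), rfl, ?_⟩)
    exact congrArg gLeft (cupPartner_skipTwo j hj u).symm
  · exact .refl _

/-- Every node of the middle bar is the end of a strand running to the outer left bar, so no
component is closed. -/
theorem loops_cupDiagram (j : ℕ) (hj : j ≤ k) (D : Diagram k m) :
    (cupDiagram k j hj).loops D = 0 :=
  gLoops_eq_zero fun b => ⟨Sum.inl (skipTwo j b), cupDiagram_path j hj D (Sum.inl b)⟩

theorem cupDiagram_path_partner (j : ℕ) (hj : j ≤ k) (D : Diagram k m) (u : Fin k ⊕ Fin m) :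
    EqvGen (glueAdj (cupDiagram k j hj).partner D.partner) (gOuter (skipNode j u))
      (gOuter (skipNode j (D.partner u))) :=
  ((cupDiagram_path j hj D u).trans _ _ _ (.rel _ _ (Or.inr ⟨u, rfl, rfl⟩))).trans _ _ _
    (cupDiagram_path j hj D _).symm

theorem cupDiagram_comp_partner (j : ℕ) (hj : j ≤ k) (D : Diagram k m) (u : Fin k ⊕ Fin m) :
    ((cupDiagram k j hj).comp D).partner (skipNode j u) = skipNode j (D.partner u) := by
  rcases (isGlue_comp _ _ _ _).1 (cupDiagram_path_partner j hj D u) with h | h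
  · exact absurd (skipNode_injective j h) (D.partner_ne u)
  · exact h.symm

theorem cupDiagram_comp_injective (j : ℕ) (hj : j ≤ k) :
    Function.Injective ((cupDiagram k j hj).comp : Diagram k m → Diagram (k + 2) m) := by
  intro D D' h
  ext1
  funext u
  apply skipNode_injective j
  rw [← cupDiagram_comp_partner j hj, ← cupDiagram_comp_partner j hj, h]

/-! ### Left cups joining neighbouring nodes -/

/-- An arc joins the left nodes `i` and `i + 1`. -/
def HasCupAt (D : Diagram m n) (i : ℕ) : Prop :=
  ∃ h : i + 1 < m, D.partner (Sum.inl ⟨i, by omega⟩) = Sum.inl ⟨i + 1, h⟩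

theorem HasCupAt.comp {D : Diagram l m} {i : ℕ} (h : D.HasCupAt i) (E : Diagram m n) :
    (D.comp E).HasCupAt i := ⟨h.1, comp_partner_inl D E h.2⟩

theorem hasCupAt_cupDiagram (j : ℕ) (hj : j ≤ k) : (cupDiagram k j hj).HasCupAt j :=
  ⟨by omega, cupPartner_left j hj⟩

/-- Delete the arc: `D` matches the remaining nodes among themselves, and their order is unchanged,
so they form a diagram `D'`. -/
theorem exists_cupDiagram_comp (j : ℕ) (hj : j ≤ k) (D : Diagram (k + 2) m) (hD : D.HasCupAt j) :
    ∃ D', (cupDiagram k j hj).comp D' = D := by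
  obtain ⟨hj', hD⟩ := hD
  have hD' : D.partner (Sum.inl ⟨j + 1, hj'⟩) = Sum.inl ⟨j, by omega⟩ := by
    rw [← hD, D.partner_partner]
  have hne := skipTwo_ne (k := k) j
  have hex : ∀ u, ∃ v, skipNode j v = D.partner (skipNode (m := m) j u) := by
    intro u
    apply exists_skipNode hj
    · intro h
      rw [← hD', (Function.LeftInverse.injective D.partner_partner).eq_iff] at h
      rcases u with u | u
      · exact (hne u).2 (congrArg Fin.val (Sum.inl_injective h))
      · cases h
    · intro h
      rw [← hD, (Function.LeftInverse.injective D.partner_partner).eq_iff] at h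
      rcases u with u | u
      · exact (hne u).1 (congrArg Fin.val (Sum.inl_injective h))
      · cases h
  choose p hp using hex
  refine ⟨⟨p, fun u => ?_, fun u h => ?_, fun u v h => ?_⟩, ?_⟩
  · apply skipNode_injective j
    rw [hp, hp, D.partner_partner]
  · have := hp u
    rw [h] at this
    exact D.partner_ne _ this.symm
  · apply D.noncrossing (skipNode j u) (skipNode j v)
    rwa [← hp, ← hp, bdPos_skipNode, bdPos_skipNode, bdPos_skipNode]
  · apply eq_comp
    refine cup_cases j hj ?_ ?_ ?_
    · rw [hD]
      exact .rel _ _ (Or.inl ⟨Sum.inl ⟨j, by omega⟩, rfl,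
        congrArg gLeft (cupPartner_left j hj).symm⟩)
    · rw [hD']
      exact .rel _ _ (Or.inl ⟨Sum.inl ⟨j + 1, by omega⟩, rfl,
        congrArg gLeft (cupPartner_right j hj).symm⟩)
    · intro u
      rw [← hp]
      exact cupDiagram_path_partner j hj _ u

/-- An arc joins the left nodes `i` and `i + 1` for some `i` with `i + 1 < j`. -/
def HasCupBelow (D : Diagram m n) (j : ℕ) : Prop := ∃ i, i + 1 < j ∧ D.HasCupAt i

theorem HasCupBelow.comp {D : Diagram l m} {j : ℕ} (h : D.HasCupBelow j) (E : Diagram m n) :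
    (D.comp E).HasCupBelow j := h.imp fun _ h => ⟨h.1, h.2.comp E⟩

theorem HasCupBelow.mono {D : Diagram m n} {i j : ℕ} (h : D.HasCupBelow i) (hij : i ≤ j) :
    D.HasCupBelow j := h.imp fun _ h => ⟨h.1.trans_le hij, h.2⟩

theorem hasCupBelow_add_two {D : Diagram m n} {j : ℕ} :
    D.HasCupBelow (j + 2) ↔ D.HasCupBelow (j + 1) ∨ D.HasCupAt j := by
  constructor
  · rintro ⟨i, hi, h⟩
    rcases (show i + 1 < j + 1 ∨ i = j by omega) with h' | rfl
    · exact Or.inl ⟨i, h', h⟩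
    · exact Or.inr h
  · rintro (h | h)
    · exact h.mono (by omega)
    · exact ⟨j, by omega, h⟩

/-- The bound drops from `j + 1` to `j` because the node `j` is used up by the new cup, so no cup
sits at `(j - 1, j)`; the nodes below `j` keep their labels. This equivalence makes cup insertion
injective on the quotients. -/
theorem hasCupBelow_cupDiagram_comp (j : ℕ) (hj : j ≤ k) (D : Diagram k m) :
    ((cupDiagram k j hj).comp D).HasCupBelow (j + 1) ↔ D.HasCupBelow j := by
  have key : ∀ i (hi : i < k), i < j →
      (Sum.inl ⟨i, by omega⟩ : Fin (k + 2) ⊕ Fin m) = skipNode j (Sum.inl ⟨i, hi⟩) := by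
    intro i hi hij
    refine congrArg Sum.inl (Fin.ext ?_)
    rw [skipTwo_val, if_pos hij]
  constructor
  · rintro ⟨i, hi, hi', h⟩
    rw [key i (by omega) (by omega), cupDiagram_comp_partner] at h
    rcases (show i + 1 < j ∨ i + 1 = j by omega) with hij | rfl
    · rw [key (i + 1) (by omega) hij] at h
      exact ⟨i, hij, by omega, skipNode_injective j h⟩
    -- Here the node `j = i + 1` would be the partner of a node coming from `D`, but it is an end of
    -- the inserted cup.
    · rcases hu : D.partner (Sum.inl ⟨i, by omega⟩) with u | u
      · rw [hu] at h
        exact absurd (congrArg Fin.val (Sum.inl_injective h)) (skipTwo_ne (i + 1) u).1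
      · rw [hu] at h; cases h
  · rintro ⟨i, hi, hi', h⟩
    refine ⟨i, by omega, by omega, ?_⟩
    rw [key i (by omega) (by omega), cupDiagram_comp_partner, h, ← key (i + 1) hi' hi]

/-- An innermost arc joins neighbours: if `i` and `i'` are not adjacent, the arc at `i + 1` is
trapped under the arc from `i` to `i'` and is shorter. -/
theorem exists_hasCupAt (D : Diagram m n) {i i' : Fin m} (hii' : i < i')
    (h : D.partner (Sum.inl i) = Sum.inl i') : D.HasCupBelow m := by
  obtain ⟨d, hd⟩ : ∃ d, (i' : ℕ) - i = d := ⟨_, rfl⟩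
  induction d using Nat.strong_induction_on generalizing i i' with
  | _ d ih =>
    rw [Fin.lt_def] at hii'
    by_cases h1 : (i' : ℕ) = i + 1
    · refine ⟨i, by omega, by omega, ?_⟩
      rw [h]
      exact congrArg Sum.inl (Fin.ext h1)
    · set x : Fin m := ⟨i + 1, by omega⟩ with hx
      have hxv : (x : ℕ) = i + 1 := rfl
      have h' : D.partner (Sum.inl i') = Sum.inl i := by rw [← h, D.partner_partner]
      -- `n1` prevents the partner of `x` from lying beyond `i'`, and `n2` from lying before `i`.
      have n1 := D.noncrossing (Sum.inl i) (Sum.inl x)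
      have n2 := D.noncrossing (D.partner (Sum.inl x)) (Sum.inl i)
      rw [h] at n1 n2
      rw [D.partner_partner] at n2
      have hz0 : D.partner (Sum.inl x) ≠ Sum.inl x := D.partner_ne _
      have hz1 : D.partner (Sum.inl x) ≠ Sum.inl i := by
        intro hz
        have := D.partner_partner (Sum.inl x)
        rw [hz, h] at this
        have := congrArg Fin.val (Sum.inl_injective this)
        omega
      have hz2 : D.partner (Sum.inl x) ≠ Sum.inl i' := by
        intro hz
        have := D.partner_partner (Sum.inl x)
        rw [hz, h'] at this
        have := congrArg Fin.val (Sum.inl_injective this)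
        omega
      rcases hz : D.partner (Sum.inl x) with z | z
      · rw [hz] at n1 n2 hz0 hz1 hz2
        rw [Ne, Sum.inl.injEq, Fin.ext_iff] at hz0 hz1 hz2
        simp only [bdPos] at n1 n2
        exact ih (z - x) (by omega) (i := x) (i' := z) (by rw [Fin.lt_def]; omega) hz rfl
      -- All right nodes come after the left ones along the boundary, so `n1` also excludes a
      -- partner on the right bar.
      · rw [hz] at n1
        simp only [bdPos] at n1
        omega

theorem hasCupBelow_of_partner (D : Diagram m n) {i i' : Fin m}
    (h : D.partner (Sum.inl i) = Sum.inl i') : D.HasCupBelow m := by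
  rcases lt_trichotomy i i' with hlt | rfl | hlt
  · exact D.exists_hasCupAt hlt h
  · exact absurd h (D.partner_ne _)
  · exact D.exists_hasCupAt hlt (by rw [← h, D.partner_partner])

theorem hasCupBelow_of_ne_id (D : Diagram n n) (h : D ≠ idDiagram n) : D.HasCupBelow n := by
  by_contra hD
  exact h (eq_id_of_no_left_cup D fun _ _ hij => hD (D.hasCupBelow_of_partner hij))

theorem not_hasCupBelow_id (j : ℕ) : ¬ (idDiagram n).HasCupBelow j := by
  rintro ⟨i, -, h, h'⟩
  cases h'

theorem hasCupBelow_of_zero (D : Diagram m 0) (hm : 0 < m) : D.HasCupBelow m := by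
  rcases h : D.partner (Sum.inl ⟨0, hm⟩) with i | i
  · exact D.hasCupBelow_of_partner h
  · exact i.elim0

theorem not_hasRightCup (D : Diagram m 0) : ¬ D.HasRightCup := fun ⟨i, _⟩ => i.elim0

/-- The arcs at `(0, 1)` and `(1, 2)` on the middle bar form a zigzag. Strand 0 runs through the
middle nodes 2, 1, 0, and every other strand `i` through `i + 2` alone, so all middle nodes are used
and no loop is left. -/
theorem capDiagram_path (hk : 1 ≤ k) (i : Fin k) :
    EqvGen (glueAdj (capDiagram k).partner (cupDiagram k 1 hk).partner)
      (gOuter (Sum.inl i)) (gOuter (Sum.inr i)) ∧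
    ∀ b : Fin (k + 2), ((b : ℕ) = i + 2 ∨ ((i : ℕ) = 0 ∧ (b : ℕ) ≤ 1)) →
      EqvGen (glueAdj (capDiagram k).partner (cupDiagram k 1 hk).partner)
        (gOuter (Sum.inl i)) (Sum.inr (Sum.inl b)) := by
  set r := EqvGen (glueAdj (capDiagram k).partner (cupDiagram k 1 hk).partner)
  have e1 : r (gOuter (Sum.inl i)) (Sum.inr (Sum.inl ⟨i + 2, by omega⟩)) :=
    .rel _ _ (Or.inl ⟨Sum.inl i, rfl, rfl⟩)
  have e2 : r (gOuter (Sum.inr i)) (Sum.inr (Sum.inl (skipTwo 1 i))) :=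
    .rel _ _ (Or.inr ⟨Sum.inr i, rfl, rfl⟩)
  have e3 : r (Sum.inr (Sum.inl ⟨0, by omega⟩)) (Sum.inr (Sum.inl ⟨1, by omega⟩)) :=
    .rel _ _ (Or.inl ⟨Sum.inr ⟨0, by omega⟩, rfl, rfl⟩)
  have e4 : r (Sum.inr (Sum.inl ⟨1, by omega⟩)) (Sum.inr (Sum.inl ⟨2, by omega⟩)) :=
    .rel _ _ (Or.inr ⟨Sum.inl ⟨1, by omega⟩, rfl, congrArg Sum.inr (cupPartner_left 1 hk).symm⟩)
  by_cases hi : (i : ℕ) = 0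
  · have f2 : (⟨i + 2, by omega⟩ : Fin (k + 2)) = ⟨2, by omega⟩ := Fin.ext (by simp only; omega)
    have f0 : skipTwo 1 i = ⟨0, by omega⟩ := Fin.ext (by rw [skipTwo_val, if_pos (by omega)]; exact hi)
    rw [f2] at e1
    rw [f0] at e2
    have g1 := e1.trans _ _ _ e4.symm
    have g0 := g1.trans _ _ _ e3.symm
    refine ⟨g0.trans _ _ _ e2.symm, fun b hb => ?_⟩
    rcases (show (b : ℕ) = 0 ∨ (b : ℕ) = 1 ∨ (b : ℕ) = 2 by omega) with hb | hb | hb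
    · rwa [show b = ⟨0, by omega⟩ from Fin.ext hb]
    · rwa [show b = ⟨1, by omega⟩ from Fin.ext hb]
    · rwa [show b = ⟨2, by omega⟩ from Fin.ext hb]
  · rw [show skipTwo 1 i = ⟨i + 2, by omega⟩ from
      Fin.ext (by rw [skipTwo_val, if_neg (by omega)])] at e2
    refine ⟨e1.trans _ _ _ e2.symm, fun b hb => ?_⟩
    rwa [show b = ⟨i + 2, by omega⟩ from Fin.ext (by simp only; omega)]

theorem capDiagram_comp_cupDiagram (hk : 1 ≤ k) :
    (capDiagram k).comp (cupDiagram k 1 hk) = idDiagram k := by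
  apply eq_comp
  rintro (i | i)
  · exact (capDiagram_path hk i).1
  · exact (capDiagram_path hk i).1.symm

theorem loops_capDiagram_cupDiagram (hk : 1 ≤ k) :
    (capDiagram k).loops (cupDiagram k 1 hk) = 0 := by
  refine gLoops_eq_zero fun b => ?_
  by_cases hb : (b : ℕ) ≤ 1
  · exact ⟨Sum.inl ⟨0, by omega⟩, (capDiagram_path hk _).2 b (Or.inr ⟨rfl, hb⟩)⟩
  · exact ⟨Sum.inl ⟨b - 2, by omega⟩, (capDiagram_path hk _).2 b (Or.inl (by simp only; omega))⟩

end Diagram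
end TemperleyLieb

/-! ### Quotients by left cups -/

namespace TemperleyLieb
open CategoryTheory TensorProduct MulOpposite

section CupQuotient
variable {R : Type u} [CommRing R] (a : R)

/-- The span of the diagrams having a left cup at `(i, i + 1)` for some `i` with `i + 1 < j`. -/
noncomputable def cupSpan (k j m : ℕ) : Submodule R (TLHom R a k m) :=
  (Finsupp.supported R R {D : Diagram k m | D.HasCupBelow j} : Submodule R (Diagram k m →₀ R))

variable {a} {k j l m n : ℕ}

theorem cupSpan_eq_span : cupSpan a k j m =
    Submodule.span R (TLHom.of a '' {D : Diagram k m | D.HasCupBelow j}) :=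
  Finsupp.supported_eq_span_single R _

theorem mem_cupSpan {x : TLHom R a k m} : x ∈ cupSpan a k j m ↔
    ∀ D : Diagram k m, ¬ D.HasCupBelow j → (show Diagram k m →₀ R from x) D = 0 :=
  Finsupp.mem_supported' R _

theorem of_mem_cupSpan {D : Diagram k m} (h : D.HasCupBelow j) : TLHom.of a D ∈ cupSpan a k j m := by
  rw [cupSpan_eq_span]
  exact Submodule.subset_span ⟨D, h, rfl⟩

theorem cupSpan_le {p : Submodule R (TLHom R a k m)}
    (h : ∀ D : Diagram k m, D.HasCupBelow j → TLHom.of a D ∈ p) : cupSpan a k j m ≤ p := by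
  rw [cupSpan_eq_span, Submodule.span_le]
  rintro _ ⟨D, hD, rfl⟩
  exact h D hD

theorem cupSpan_eq_bot (hj : j ≤ 1) : cupSpan a k j m = ⊥ :=
  le_bot_iff.1 (cupSpan_le fun _ ⟨_, hi, _⟩ => by omega)

variable (R) in
/-- The quotient of `TL(k, m)` by the diagrams having a left cup at `(i, i + 1)` for some `i` with
`i + 1 < j`. -/
def CupQuotient (a : R) (k j m : ℕ) : Type u := TLHom R a k m ⧸ cupSpan a k j m

noncomputable instance : AddCommGroup (CupQuotient R a k j m) :=
  inferInstanceAs (AddCommGroup (TLHom R a k m ⧸ cupSpan a k j m))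
noncomputable instance : Module R (CupQuotient R a k j m) :=
  inferInstanceAs (Module R (TLHom R a k m ⧸ cupSpan a k j m))

namespace CupQuotient

variable (a k j m) in
/-- The quotient map. -/
noncomputable def mk : TLHom R a k m →ₗ[R] CupQuotient R a k j m := (cupSpan a k j m).mkQ

theorem mk_surjective : Function.Surjective (mk a k j m) := Submodule.mkQ_surjective _

theorem mk_eq_zero {x : TLHom R a k m} : mk a k j m x = 0 ↔ x ∈ cupSpan a k j m :=
  Submodule.Quotient.mk_eq_zero _

/-- Descend a linear map to the quotient. -/
noncomputable def lift {P : Type u} [AddCommGroup P] [Module R P] (f : TLHom R a k m →ₗ[R] P)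
    (h : ∀ D : Diagram k m, D.HasCupBelow j → f (TLHom.of a D) = 0) :
    CupQuotient R a k j m →ₗ[R] P :=
  (cupSpan a k j m).liftQ f (cupSpan_le h)

variable (a k j l m) in
/-- Composition `TL(k, l) / ~ → TL(l, m) → TL(k, m) / ~`. -/
noncomputable def comp : CupQuotient R a k j l →ₗ[R] TLHom R a l m →ₗ[R] CupQuotient R a k j m :=
  lift ((TLHom.comp a).compr₂ (mk a k j m)) fun D hD => TLHom.hom_ext fun E => by
    rw [LinearMap.compr₂_apply, TLHom.comp_of, map_smul, mk_eq_zero.2 (of_mem_cupSpan (hD.comp E)),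
      smul_zero]
    rfl

theorem comp_mk (x : TLHom R a k l) (y : TLHom R a l m) :
    comp a k j l m (mk a k j l x) y = mk a k j m (TLHom.comp a x y) := rfl

theorem comp_assoc (x : CupQuotient R a k j l) (y : TLHom R a l m) (z : TLHom R a m n) :
    comp a k j m n (comp a k j l m x y) z = comp a k j l n x (TLHom.comp a y z) := by
  obtain ⟨x, rfl⟩ := mk_surjective x
  rw [comp_mk, comp_mk, comp_mk, TLHom.comp_assoc]

noncomputable instance : Module (TLAlg R a m)ᵐᵒᵖ (CupQuotient R a k j m) where
  smul x y := comp a k j m m y (unop x)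
  mul_smul x y z := (comp_assoc z (unop y) (unop x)).symm
  one_smul y := by
    obtain ⟨y, rfl⟩ := mk_surjective y
    exact congrArg _ (TLHom.comp_id y)
  smul_zero x := LinearMap.map_zero₂ (comp a k j m m) (unop x)
  zero_smul x := map_zero (comp a k j m m x)
  smul_add x y z := LinearMap.map_add₂ (comp a k j m m) y z (unop x)
  add_smul x y z := map_add (comp a k j m m z) (unop x) (unop y)

instance : IsScalarTower R (TLAlg R a m)ᵐᵒᵖ (CupQuotient R a k j m) where
  smul_assoc r x y := map_smul (comp a k j m m y) r (unop x)

end CupQuotient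

variable (a) in
/-- The left module `TL(m, 0)`. -/
noncomputable abbrev closingModule (m : ℕ) : AlgMod R (TLAlg R a m) :=
  { carrier := TLHom R a m 0 }

variable (a) in
/-- The coefficients given by `CupQuotient`. -/
noncomputable def cupCoeff (k j m : ℕ) : BarCoeff (closingModule a m) where
  M := CupQuotient R a k j m
  Y := CupQuotient R a k j 0
  φ := TensorProduct.lift (CupQuotient.comp a k j m 0)
  balanced x b y := CupQuotient.comp_assoc x b y

variable (a) in
/-- The coefficients of the complex of planar loops. -/
noncomputable def loopCoeff (m : ℕ) : BarCoeff (closingModule a m) where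
  M := TLHom R a 0 m
  Y := TLHom R a 0 0
  φ := TensorProduct.lift (TLHom.comp a)
  balanced x b y := TLHom.comp_assoc x b y

variable (a) in
/-- The trivial module as coefficients. -/
noncomputable def trivCoeff (m : ℕ) : BarCoeff (closingModule a m) where
  M := TLTriv a m
  Y := PUnit
  φ := 0
  balanced _ _ _ := rfl

namespace CupQuotient

theorem comp_cup_of (hj : j ≤ k) (D : Diagram k m) :
    TLHom.comp a (TLHom.of a (Diagram.cupDiagram k j hj)) (TLHom.of a D) =
      TLHom.of a ((Diagram.cupDiagram k j hj).comp D) := by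
  rw [TLHom.comp_of, Diagram.loops_cupDiagram, pow_zero, one_smul]

/-- Composition with the cup creates no loops and is injective on diagrams, so it merely relabels
coefficients. -/
theorem comp_cup_apply (hj : j ≤ k) (x : TLHom R a k m) (D : Diagram k m) :
    (show Diagram (k + 2) m →₀ R from
      TLHom.comp a (TLHom.of a (Diagram.cupDiagram k j hj)) x) ((Diagram.cupDiagram k j hj).comp D) =
      (show Diagram k m →₀ R from x) D := by
  have : TLHom.comp a (TLHom.of a (Diagram.cupDiagram k j hj)) =
      (Finsupp.lmapDomain R R (Diagram.cupDiagram k j hj).comp :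
        (Diagram k m →₀ R) →ₗ[R] (Diagram (k + 2) m →₀ R)) :=
    TLHom.hom_ext fun D => (comp_cup_of hj D).trans Finsupp.mapDomain_single.symm
  rw [this]
  exact Finsupp.mapDomain_apply (Diagram.cupDiagram_comp_injective j hj) x D

/-- The map induced by inserting a cup. -/
noncomputable def insertCup (a : R) (m : ℕ) (hj : j ≤ k) :
    CupQuotient R a k j m →ₗ[R] CupQuotient R a (k + 2) (j + 1) m :=
  lift (mk a (k + 2) (j + 1) m ∘ₗ TLHom.comp a (TLHom.of a (Diagram.cupDiagram k j hj)))
    fun D hD => by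
      rw [LinearMap.comp_apply, comp_cup_of, mk_eq_zero]
      exact of_mem_cupSpan ((Diagram.hasCupBelow_cupDiagram_comp j hj D).2 hD)

theorem insertCup_mk (hj : j ≤ k) (x : TLHom R a k m) : insertCup a m hj (mk a k j m x) =
    mk a (k + 2) (j + 1) m (TLHom.comp a (TLHom.of a (Diagram.cupDiagram k j hj)) x) := rfl

theorem insertCup_comp (hj : j ≤ k) (x : CupQuotient R a k j l) (y : TLHom R a l m) :
    insertCup a m hj (comp a k j l m x y) = comp a (k + 2) (j + 1) l m (insertCup a l hj x) y := by
  obtain ⟨x, rfl⟩ := mk_surjective x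
  rw [comp_mk, insertCup_mk, insertCup_mk, comp_mk, TLHom.comp_assoc]

/-- The submodules are spanned by diagrams, so membership is tested on coefficients; that of `D` in
`x` reappears at `D` with the cup inserted, which is killed exactly when `D` is. -/
theorem insertCup_injective (hj : j ≤ k) : Function.Injective (insertCup a m hj) := by
  rw [injective_iff_map_eq_zero]
  intro x hx
  obtain ⟨x, rfl⟩ := mk_surjective x
  rw [insertCup_mk, mk_eq_zero, mem_cupSpan] at hx
  rw [mk_eq_zero, mem_cupSpan]
  intro D hD
  rw [← comp_cup_apply hj x D]
  exact hx _ (fun h => hD ((Diagram.hasCupBelow_cupDiagram_comp j hj D).1 h))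

variable (a k j m) in
/-- The projection that also annihilates the diagrams having a cup at `(j, j + 1)`. -/
noncomputable def proj : CupQuotient R a k (j + 1) m →ₗ[R] CupQuotient R a k (j + 2) m :=
  lift (mk a k (j + 2) m) fun _ hD => mk_eq_zero.2 (of_mem_cupSpan (hD.mono (by omega)))

theorem proj_mk (x : TLHom R a k m) : proj a k j m (mk a k (j + 1) m x) = mk a k (j + 2) m x := rfl

theorem proj_comp (x : CupQuotient R a k (j + 1) l) (y : TLHom R a l m) :
    proj a k j m (comp a k (j + 1) l m x y) = comp a k (j + 2) l m (proj a k j l x) y := by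
  obtain ⟨x, rfl⟩ := mk_surjective x
  rfl

theorem proj_surjective : Function.Surjective (proj a k j m) := by
  intro x
  obtain ⟨x, rfl⟩ := mk_surjective x
  exact ⟨mk a k (j + 1) m x, rfl⟩

/-- The diagrams newly killed are those with a cup at `(j, j + 1)`, and these are exactly the ones
that factor through the inserted cup. -/
theorem exact_insertCup_proj (hj : j ≤ k) :
    Function.Exact (insertCup a m hj) (proj a (k + 2) j m) := by
  intro x
  obtain ⟨x, rfl⟩ := mk_surjective x
  constructor
  · intro hx
    rw [proj_mk, mk_eq_zero] at hx
    refine cupSpan_le (p := (LinearMap.range (insertCup a m hj)).comap (mk a (k + 2) (j + 1) m))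
      (fun D hD => ?_) hx
    rw [Submodule.mem_comap, LinearMap.mem_range]
    rcases Diagram.hasCupBelow_add_two.1 hD with hD | hD
    · exact ⟨0, by rw [map_zero, mk_eq_zero.2 (of_mem_cupSpan hD)]⟩
    · obtain ⟨D, rfl⟩ := Diagram.exists_cupDiagram_comp j hj D hD
      exact ⟨mk a k j m (TLHom.of a D), by rw [insertCup_mk, comp_cup_of]⟩
  · rintro ⟨y, hy⟩
    obtain ⟨y, rfl⟩ := mk_surjective y
    rw [← hy, insertCup_mk, proj_mk]
    have : mk a (k + 2) (j + 2) m ∘ₗ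
        TLHom.comp a (TLHom.of a (Diagram.cupDiagram k j hj)) = 0 :=
      TLHom.hom_ext fun D => by
        rw [LinearMap.comp_apply, comp_cup_of, mk_eq_zero.2 (of_mem_cupSpan ?_)]
        · rfl
        · exact Diagram.hasCupBelow_add_two.2
            (Or.inr ((Diagram.hasCupAt_cupDiagram j hj).comp D))
    exact LinearMap.congr_fun this y

end CupQuotient

open CupQuotient

/-! ### Acyclicity and dimension shifting -/

/-- `insertCup` as a morphism of coefficients. -/
noncomputable def insertCupHom (a : R) (m : ℕ) (hj : j ≤ k) :
    BarCoeff.Hom (cupCoeff a k j m) (cupCoeff a (k + 2) (j + 1) m) where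
  f := insertCup a m hj
  f_op_smul b x := insertCup_comp hj x b
  g := insertCup a 0 hj
  comm x y := insertCup_comp hj x y

/-- `proj` as a morphism of coefficients. -/
noncomputable def projHom (a : R) (k j m : ℕ) :
    BarCoeff.Hom (cupCoeff a k (j + 1) m) (cupCoeff a k (j + 2) m) where
  f := proj a k j m
  f_op_smul b x := proj_comp x b
  g := proj a k j 0
  comm x y := proj_comp x y

theorem isShortExact_cup (hj : j ≤ k) :
    BarCoeff.IsShortExact (insertCupHom a m hj) (projHom a (k + 2) j m) where
  injective_f := insertCup_injective hj
  exact_f := exact_insertCup_proj hj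
  surjective_f := proj_surjective
  injective_g := insertCup_injective hj
  exact_g := exact_insertCup_proj hj
  surjective_g := proj_surjective

instance : Module.Free R (TLHom R a k m) := inferInstanceAs (Module.Free R (Diagram k m →₀ R))
instance : Module.Free R (TLAlg R a m) := inferInstanceAs (Module.Free R (TLHom R a m m))

/-- Stack `d` caps and `d` cups so that each matching pair cancels as a zigzag. The zigzag needs a
through strand; for `k = 0` and `d > 0` a closed loop always appears and every composite is a
multiple of `a`. -/
theorem exists_retract (a : R) (hk : 1 ≤ k) (d : ℕ) :
    ∃ (α : TLHom R a k (k + 2 * d)) (β : TLHom R a (k + 2 * d) k),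
      TLHom.comp a α β = TLHom.of a (Diagram.idDiagram k) := by
  induction d with
  | zero => exact ⟨_, _, TLHom.id_comp _⟩
  | succ d ih =>
    obtain ⟨α, β, h⟩ := ih
    have hd : 1 ≤ k + 2 * d := by omega
    refine ⟨TLHom.comp a α (TLHom.of a (Diagram.capDiagram (k + 2 * d))),
      TLHom.comp a (TLHom.of a (Diagram.cupDiagram (k + 2 * d) 1 hd)) β, ?_⟩
    -- Reassociation brings the innermost cap and cup together; they cancel, leaving `α` composed
    -- with `β`.
    rw [TLHom.comp_assoc, ← TLHom.comp_assoc (TLHom.of a _) (TLHom.of a _), TLHom.comp_of,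
      Diagram.loops_capDiagram_cupDiagram, Diagram.capDiagram_comp_cupDiagram, pow_zero, one_smul,
      TLHom.id_comp, h]

theorem cupCoeff_acyclic_of_le_one (a : R) (hk : 1 ≤ k) (hj : j ≤ 1) (hm : ∃ d, m = k + 2 * d) :
    (cupCoeff a k j m).complex.Acyclic := by
  obtain ⟨d, rfl⟩ := hm
  obtain ⟨α, β, h⟩ := exists_retract a hk d
  -- Left multiplication by `β` descends because for `j ≤ 1` no diagram is killed. It serves both as
  -- `M → A` and, with empty right bar, as `Y → X`.
  let ret (m : ℕ) : CupQuotient R a k j m →ₗ[R] TLHom R a (k + 2 * d) m :=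
    CupQuotient.lift (TLHom.comp a β) fun _ ⟨_, hi, _⟩ => by omega
  have ret_comp : ∀ l m (x : CupQuotient R a k j l) (y : TLHom R a l m),
      ret m (CupQuotient.comp a k j l m x y) = TLHom.comp a (ret l x) y := by
    intro l m x y
    obtain ⟨x, rfl⟩ := CupQuotient.mk_surjective x
    exact (TLHom.comp_assoc β x y).symm
  have comp_ret : ∀ m (x : CupQuotient R a k j m),
      CupQuotient.comp a k j _ m (CupQuotient.mk a k j _ α) (ret m x) = x := by
    intro m x
    obtain ⟨x, rfl⟩ := CupQuotient.mk_surjective x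
    refine congrArg (CupQuotient.mk a k j m) ((TLHom.comp_assoc α β x).symm.trans ?_)
    rw [h, TLHom.id_comp]
  exact BarCoeff.acyclic_of_retract (c := cupCoeff a k j (k + 2 * d))
    (CupQuotient.mk a k j _ α) (ret _) (ret 0) (fun x b => ret_comp _ _ x b) (comp_ret _)
    (fun x y => ret_comp _ _ x y) (comp_ret 0)

theorem closingModule_flat : Module.Flat R (closingModule a m).carrier :=
  inferInstanceAs (Module.Flat R (TLHom R a m 0))

theorem cupCoeff_acyclic (a : R) (hj : j < k) (hm : ∃ d, m = k + 2 * d) :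
    (cupCoeff a k j m).complex.Acyclic := by
  -- The sequence expresses the case `j + 2` through `j` and `j + 1`, and its first term also lowers
  -- `k` by 2. Both earlier cases still satisfy the strict inequality.
  induction j using Nat.twoStepInduction generalizing k with
  | zero => exact cupCoeff_acyclic_of_le_one a hj (by omega) hm
  | one => exact cupCoeff_acyclic_of_le_one a (by omega) le_rfl hm
  | more j ih₁ ih₂ =>
    obtain ⟨k, rfl⟩ : ∃ k', k = k' + 2 := ⟨k - 2, by omega⟩
    obtain ⟨d, hd⟩ := hm
    exact (isShortExact_cup (a := a) (m := m) (show j ≤ k by omega)).acyclic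
      inferInstance closingModule_flat (ih₁ (by omega) ⟨d + 1, by omega⟩)
      (ih₂ (by omega) ⟨d, hd⟩)

/-- Dimension shifting along the short exact sequences of `isShortExact_cup` with `j = k`. -/
theorem cupCoeff_homology (a : R) (hm : Even m) (i : ℕ) (hi : 2 * i ≤ m) :
    (∀ q < i, Limits.IsZero ((cupCoeff a (2 * i) (2 * i) m).complex.homology q)) ∧
    ∀ q, Nonempty ((cupCoeff a (2 * i) (2 * i) m).complex.homology (q + i) ≅
      (cupCoeff a 0 0 m).complex.homology q) := by
  obtain ⟨t, ht⟩ := hm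
  induction i with
  | zero => exact ⟨fun q hq => absurd hq (by omega), fun q => ⟨Iso.refl _⟩⟩
  | succ i ih =>
    obtain ⟨ih₁, ih₂⟩ := ih (by omega)
    have hS := isShortExact_cup (a := a) (m := m) (le_refl (2 * i))
    -- Only the middle term has `j < k`; the outer terms have `j = k`. The number of caps in the
    -- retract is a genuine difference because `2 * (i + 1) ≤ m`.
    have h₂ : (cupCoeff a (2 * i + 2) (2 * i + 1) m).complex.Acyclic :=
      cupCoeff_acyclic a (by omega) ⟨t - (i + 1), by omega⟩
    have hiso := hS.homologyIso inferInstance closingModule_flat h₂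
    constructor
    · rintro (_ | q) hq
      · exact (hS.exactAt_zero (h₂ 0)).isZero_homology
      · exact (ih₁ q (by omega)).of_iso (hiso q).some
    · intro q
      exact ⟨(hiso (q + i)).some ≪≫ (ih₂ q).some⟩

/-! ### The two ends of the chain: planar loops and the trivial module -/

/-- The quotient map as a morphism of coefficients. -/
noncomputable def loopHom (a : R) (m : ℕ) : BarCoeff.Hom (loopCoeff a m) (cupCoeff a 0 0 m) where
  f := CupQuotient.mk a 0 0 m
  f_op_smul _ _ := rfl
  g := CupQuotient.mk a 0 0 0
  comm _ _ := rfl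

theorem CupQuotient.mk_bijective (hj : j ≤ 1) : Function.Bijective (CupQuotient.mk a k j m) := by
  refine ⟨(injective_iff_map_eq_zero _).2 fun x hx => ?_, CupQuotient.mk_surjective⟩
  rwa [CupQuotient.mk_eq_zero, cupSpan_eq_bot hj, Submodule.mem_bot] at hx

theorem loopCoeff_homology (a : R) (m q : ℕ) : Nonempty
    ((loopCoeff a m).complex.homology q ≅ (cupCoeff a 0 0 m).complex.homology q) :=
  have := (loopHom a m).isIso_map (CupQuotient.mk_bijective zero_le_one)
    (CupQuotient.mk_bijective zero_le_one)
  ⟨(HomologicalComplex.homologyFunctor _ _ q).mapIso (asIso (loopHom a m).map)⟩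

theorem counit_of_hasCupBelow {D : Diagram m m} (h : D.HasCupBelow j) :
    TLHom.counit a m (TLHom.of a D) = 0 := by
  classical
  rw [TLHom.counit_of, if_neg]
  rintro rfl
  exact Diagram.not_hasCupBelow_id j h

theorem counit_apply (x : TLHom R a m m) :
    TLHom.counit a m x = (show Diagram m m →₀ R from x) (Diagram.idDiagram m) := by
  classical
  have : TLHom.counit a m = (Finsupp.lapply (Diagram.idDiagram m) : (Diagram m m →₀ R) →ₗ[R] R) := by
    refine TLHom.hom_ext fun D => ?_
    rw [TLHom.counit_of]
    exact Finsupp.single_apply.symm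
  exact LinearMap.congr_fun this x

variable (a m) in
/-- The map to the trivial module induced by the counit. -/
noncomputable def counitQuotient : CupQuotient R a m m m →ₗ[R] R :=
  CupQuotient.lift (TLHom.counit a m) fun _ hD => counit_of_hasCupBelow hD

/-- The map to the trivial module as a morphism of coefficients. -/
noncomputable def trivHom (a : R) (m : ℕ) : BarCoeff.Hom (cupCoeff a m m m) (trivCoeff a m) where
  f := counitQuotient a m
  f_op_smul b x := by
    obtain ⟨x, rfl⟩ := CupQuotient.mk_surjective x
    exact (TLHom.counit_comp x b).trans (mul_comm (G := R) _ _)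
  g := 0
  comm _ _ := rfl

/-- Every diagram other than the identity has a left cup between neighbours, so in the quotient only
the coefficient of the identity survives, and the counit reads it off. -/
theorem trivHom_f_bijective (a : R) (m : ℕ) : Function.Bijective (trivHom a m).f := by
  refine ⟨(injective_iff_map_eq_zero _).2 fun x hx => ?_, fun r => ?_⟩
  · obtain ⟨x, rfl⟩ := CupQuotient.mk_surjective x
    refine CupQuotient.mk_eq_zero.2 (mem_cupSpan.2 fun D hD => ?_)
    rw [show D = Diagram.idDiagram m from by_contra fun h => hD (D.hasCupBelow_of_ne_id h),
      ← counit_apply]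
    exact hx
  · refine ⟨CupQuotient.mk a m m m ((show R from r) • TLHom.of a (Diagram.idDiagram m)), ?_⟩
    classical
    change TLHom.counit a m ((show R from r) • TLHom.of a (Diagram.idDiagram m)) = r
    rw [map_smul, TLHom.counit_of, if_pos rfl]
    exact mul_one (M := R) r

theorem CupQuotient.subsingleton (hk : 0 < k) : Subsingleton (CupQuotient R a k k 0) := by
  refine ⟨fun x y => ?_⟩
  obtain ⟨x, rfl⟩ := CupQuotient.mk_surjective x
  obtain ⟨y, rfl⟩ := CupQuotient.mk_surjective y
  rw [← sub_eq_zero, ← map_sub, CupQuotient.mk_eq_zero, mem_cupSpan]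
  exact fun D hD => absurd (D.hasCupBelow_of_zero hk) hD

/-- Positivity of `m` is what makes the degree 0 terms agree: a diagram in `TL(m, 0)` must match its
left nodes among themselves, so both terms vanish. -/
theorem trivCoeff_homology (a : R) (hm : 0 < m) (q : ℕ) : Nonempty
    ((cupCoeff a m m m).complex.homology q ≅ (trivCoeff a m).complex.homology q) :=
  have : Subsingleton (cupCoeff a m m m).Y := CupQuotient.subsingleton hm
  have : Subsingleton (trivCoeff a m).Y := inferInstanceAs (Subsingleton PUnit)
  have := (trivHom a m).isIso_map (trivHom_f_bijective a m)
    ⟨Function.injective_of_subsingleton _, fun _ => ⟨0, Subsingleton.elim _ _⟩⟩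
  ⟨(HomologicalComplex.homologyFunctor _ _ q).mapIso (asIso (trivHom a m).map)⟩

theorem rightCupSubmodule_zero : rightCupSubmodule a m 0 = ⊥ := by
  rw [rightCupSubmodule, Submodule.span_eq_bot]
  rintro _ ⟨D, hD, -⟩
  exact absurd hD D.not_hasRightCup

/-- An empty right bar admits no right cup, so the cell module is `TL(m, 0)` itself and
`BarCoeff.torIso` applies. -/
theorem torModule_cellModule (a : R) (m q : ℕ) : Nonempty
    (TorModule R (TLAlg R a m) (TLTriv a m) q (CellModule a m 0) ≅
      (trivCoeff a m).complex.homology (q + 1)) := by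
  have : Subsingleton (trivCoeff a m).Y := inferInstanceAs (Subsingleton PUnit)
  obtain ⟨e⟩ := (trivCoeff a m).torIso inferInstance
    (inferInstanceAs (Module.Projective R (TLHom R a m 0))) q
  exact ⟨((tensorFunctor R (TLAlg R a m) (TLTriv a m)).leftDerived q).mapIso
    (Submodule.quotEquivOfEqBot _ rightCupSubmodule_zero).toModuleIso ≪≫ e⟩

theorem torModule_cellModule_iso (a : R) (hm : 0 < m) (q : ℕ) : Nonempty
    (TorModule R (TLAlg R a m) (TLTriv a m) q (CellModule a m 0) ≅
      (cupCoeff a m m m).complex.homology (q + 1)) :=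
  ⟨(torModule_cellModule a m q).some ≪≫ (trivCoeff_homology a hm (q + 1)).some.symm⟩

end CupQuotient
end TemperleyLieb

/-! ### Assembly -/

theorem mainTheorem7 {R : Type*} [CommRing R] (a : R) (n : ℕ) (hn : 1 ≤ n) (q : ℕ) :
    (q < n - 1 → CategoryTheory.Limits.IsZero
      (TemperleyLieb.TorModule R (TemperleyLieb.TLAlg R a (2 * n))
        (TemperleyLieb.TLTriv a (2 * n)) q (TemperleyLieb.CellModule a (2 * n) 0))) ∧
    (n - 1 ≤ q → Nonempty
      (TemperleyLieb.TorModule R (TemperleyLieb.TLAlg R a (2 * n))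
        (TemperleyLieb.TLTriv a (2 * n)) q (TemperleyLieb.CellModule a (2 * n) 0) ≅
      (TemperleyLieb.planarLoops a n).homology (q - (n - 1)))) := by
  obtain ⟨e⟩ := TemperleyLieb.torModule_cellModule_iso a (show 0 < 2 * n by omega) q
  obtain ⟨h₁, h₂⟩ := TemperleyLieb.cupCoeff_homology a (even_two_mul n) n le_rfl
  -- `Tor_q` sits in degree `q + 1` of the cone, so the `n` shifts give vanishing for `q + 1 < n`.
  refine ⟨fun hq => (h₁ (q + 1) (by omega)).of_iso e, fun hq => ?_⟩
  obtain ⟨e₂⟩ := h₂ (q - (n - 1))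
  rw [show q - (n - 1) + n = q + 1 by omega] at e₂
  obtain ⟨e₃⟩ := TemperleyLieb.loopCoeff_homology a (2 * n) (q - (n - 1))
  -- `planarLoops a n` unfolds to the complex of `loopCoeff a (2 * n)`.
  exact ⟨e ≪≫ e₂ ≪≫ e₃.symm⟩
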